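/- Let $n\ge 4$. Let $D_n$ be the Coxeter graph with vertices $\overline{1},1,2,\dots,n-1$, in which $1,2,\dots,n-1$ form a path (with $i$ joined to $i+1$), $\overline{1}$ is joined to $2$, and there are no other edges. Let $\mathrm{TL}(D_n)$ be the associative unital $\mathbb{Z}[\delta]$-algebra ($\delta$ an indeterminate) with generators $b_{\overline{1}},b_1,\dots,b_{n-1}$ and defining relations $b_i^2=\delta b_i$ for all $i$; $b_ib_j=b_jb_i$ if $i$ and $j$ are not joined in $D_n$; and $b_ib_jb_i=b_i$ if $i$ and $j$ are joined in $D_n$. Let the pair-free Temperley--Lieb algebra $\mathrm{PFTL}(D_n)$ be the quotient of $\mathrm{TL}(D_n)$ by the relation $b_1b_{\overline{1}}=0$. Then $\mathrm{PFTL}(D_n)$ is a cellular algebra over $\mathbb{Z}[\delta]$. Here an associative unital algebra $A$ over a commutative ring $R$ is called cellular if it has a cell datum $(\Lambda,M,C,*)$, that is: 1. $\Lambda$ is a poset, $M(\lambda)$ is a finite set for each $\lambda\in\Lambda$, and $C:\coprod_{\lambda\in\Lambda}M(\lambda)\times M(\lambda)\to A$ is injective with image an $R$-basis of $A$; write $C^{\lambda}_{S,T}=C(S,T)$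 for $S,T\in M(\lambda)$. 2. $*$ is an $R$-linear involutory anti-automorphism of $A$ with $(C^{\lambda}_{S,T})^*=C^{\lambda}_{T,S}$ for all $\lambda\in\Lambda$ and $S,T\in M(\lambda)$. 3. For all $\lambda\in\Lambda$, $S,T\in M(\lambda)$ and $a\in A$, $$aC^{\lambda}_{S,T}\equiv\sum_{S'\in M(\lambda)}r_a(S',S)\,C^{\lambda}_{S',T}\pmod{A(<\lambda)},$$ where $r_a(S',S)\in R$ is independent of $T$, and $A(<\lambda)$ is the $R$-submodule of $A$ generated by all $C^{\mu}_{S'',T''}$ with $\mu<\lambda$ and $S'',T''\in M(\mu)$. -/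

import Mathlib

open Polynomial

universe u v

/-- A cell datum `(Λ, M, C, *)` for an associative unital algebra `A` over a commutative ring
`R`. -/
structure CellDatum (R : Type u) (A : Type v) [CommRing R] [Ring A] [Algebra R A] where
  /-- the poset `Λ` -/
  Λ : Type v
  [order : PartialOrder Λ]
  /-- the finite sets `M(l)`, for `l ∈ Λ` -/
  M : Λ → Type v
  [fintype : ∀ l, Fintype (M l)]
  /-- the map `C : ∐ M(l) × M(l) → A`, injective with image an `R`-basis of `A` -/
  C : (Σ l, M l × M l) → A
  C_injective : Function.Injective C
  C_linearIndependent : LinearIndependent R C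
  C_span : Submodule.span R (Set.range C) = ⊤
  /-- the `R`-linear involutory anti-automorphism `*` -/
  star : A →ₗ[R] A
  star_star : ∀ a, star (star a) = a
  star_mul : ∀ a b, star (a * b) = star b * star a
  star_C : ∀ (l : Λ) (S T : M l), star (C ⟨l, S, T⟩) = C ⟨l, T, S⟩
  /-- multiplication modulo `A(< l)`; the coefficients `r S' S` do not depend on `T` -/
  mul_C : ∀ (a : A) (l : Λ), ∃ r : M l → M l → R, ∀ S T : M l,
    a * C ⟨l, S, T⟩ - ∑ S', r S' S • C ⟨l, S', T⟩ ∈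
      Submodule.span R {x : A | ∃ m : Λ, m < l ∧ ∃ S'' T'' : M m, x = C ⟨m, S'', T''⟩}

/-- An algebra is cellular if it admits a cell datum. -/
def IsCellular (R : Type u) (A : Type v) [CommRing R] [Ring A] [Algebra R A] : Prop :=
  Nonempty (CellDatum R A)

/-- The Coxeter graph of type `D_n`. The vertex `0` stands for `s_{1̄}`, the vertex `i ≥ 1` for
`s_i`: the vertices `1, …, n - 1` form a path, and `0` is joined to `2` only. -/
def coxeterGraphD (n : ℕ) : SimpleGraph (Fin n) :=
  SimpleGraph.fromRel fun i j =>
    (1 ≤ i.val ∧ j.val = i.val + 1) ∨ (i.val = 0 ∧ j.val = 2)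

/-- The defining relations of `TL(D_n)` over `ℤ[δ]`, where `δ = X`. -/
inductive TLD.Rel (n : ℕ) : FreeAlgebra ℤ[X] (Fin n) → FreeAlgebra ℤ[X] (Fin n) → Prop
  | sq (i : Fin n) :
      TLD.Rel n (FreeAlgebra.ι ℤ[X] i * FreeAlgebra.ι ℤ[X] i)
        ((X : ℤ[X]) • FreeAlgebra.ι ℤ[X] i)
  | comm (i j : Fin n) (h : ¬ (coxeterGraphD n).Adj i j) :
      TLD.Rel n (FreeAlgebra.ι ℤ[X] i * FreeAlgebra.ι ℤ[X] j)
        (FreeAlgebra.ι ℤ[X] j * FreeAlgebra.ι ℤ[X] i)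
  | braid (i j : Fin n) (h : (coxeterGraphD n).Adj i j) :
      TLD.Rel n (FreeAlgebra.ι ℤ[X] i * FreeAlgebra.ι ℤ[X] j * FreeAlgebra.ι ℤ[X] i)
        (FreeAlgebra.ι ℤ[X] i)

/-- The Temperley–Lieb algebra `TL(D_n)` over `ℤ[δ]`. -/
def TLD (n : ℕ) : Type := RingQuot (TLD.Rel n)

noncomputable instance (n : ℕ) : Ring (TLD n) :=
  inferInstanceAs (Ring (RingQuot (TLD.Rel n)))

noncomputable instance (n : ℕ) : Algebra ℤ[X] (TLD n) :=
  inferInstanceAs (Algebra ℤ[X] (RingQuot (TLD.Rel n)))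

/-- The quotient map from the free algebra onto `TL(D_n)`. -/
noncomputable def TLD.mk (n : ℕ) : FreeAlgebra ℤ[X] (Fin n) →ₐ[ℤ[X]] TLD n :=
  RingQuot.mkAlgHom ℤ[X] (TLD.Rel n)

/-- The generator `b_i` of `TL(D_n)`; `b_{1̄}` has index `0`. -/
noncomputable def TLD.b {n : ℕ} (i : Fin n) : TLD n :=
  TLD.mk n (FreeAlgebra.ι ℤ[X] i)

/-- The relation `b_1 b_{1̄} = 0`. -/
inductive PFTLD.Rel (n : ℕ) : TLD n → TLD n → Prop
  | pair (i j : Fin n) (hi : i.val = 1) (hj : j.val = 0) :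
      PFTLD.Rel n (TLD.b i * TLD.b j) 0

/-- The pair-free Temperley–Lieb algebra `PFTL(D_n)`: the quotient of `TL(D_n)` by the relation
`b_1 b_{1̄} = 0`. -/
def PFTLD (n : ℕ) : Type := RingQuot (PFTLD.Rel n)

noncomputable instance (n : ℕ) : Ring (PFTLD n) :=
  inferInstanceAs (Ring (RingQuot (PFTLD.Rel n)))

noncomputable instance (n : ℕ) : Algebra ℤ[X] (PFTLD n) :=
  inferInstanceAs (Algebra ℤ[X] (RingQuot (PFTLD.Rel n)))

/-!
Diagrammatically, `PFTL(D_n)` has a basis of decorated Temperley–Lieb diagrams. Cutting such a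
diagram at its through strands leaves two half-diagrams, and reading a half-diagram from left to
right gives a walk in the branching graph of the tower of algebras: one vertex for each positive
number of through strands, and two vertices without through strands, for the two parities of the
number of decorations. The cellular basis consists of the products `w e w'*`, where `e` is the
simplest monomial with the given end vertex and `w`, `w'` are products of such monomials along two
walks to it.

These products span because at each level a generator times `e` lies, modulo the ideal generated by
the monomials with fewer through strands, in the span of the `w e`; this is an induction along the
tower. They are independent because of a representation on functions of colourings of the strands
by `d` pairs of opposite colours, in which `δ` acts as `2 d`: a nested word read off a walk detects
the corresponding element, and the pairing is triangular with respect to the number of through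
strands once `d` is large. A coefficient of a linear relation therefore vanishes at infinitely many
integers.
-/

namespace PairFree

/-! ### The Bratteli diagram -/

/-- The vertices of the branching graph of the tower `PFTL(D_n)`. With no through strand there are
two of them, told apart by the parity of the number of decorations: `through 0` is the even one. -/
inductive Vertex : Type
  | through (r : ℕ)
  | odd
  deriving DecidableEq

namespace Vertex

/-- The number of through strands. -/
def rank : Vertex → ℕ
  | through r => r
  | odd => 0

/-- The first level of the tower at which a vertex occurs. The decorated vertex has to wait for the
generator `b 0`, which lives on two strands. -/
def base : Vertex → ℕ
  | through r => r
  | odd => 2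

/-- The neighbour with one more through strand. -/
def up : Vertex → Vertex
  | through r => through (r + 1)
  | odd => through 1

@[simp]
theorem rank_up (v : Vertex) : v.up.rank = v.rank + 1 := by
  cases v <;> rfl

theorem up_eq_of_rank_succ_eq {v w : Vertex} (h : v.rank + 1 = w.rank) : v.up = w := by
  cases v <;> cases w <;> simp_all [rank, up]

/-- `AtLevel n v` says that the vertex `v` occurs at level `n` of the tower. -/
inductive AtLevel : ℕ → Vertex → Prop
  | base (v : Vertex) : AtLevel v.base v
  | add_two {n : ℕ} {v : Vertex} : AtLevel n v → AtLevel (n + 2) v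

namespace AtLevel

variable {n : ℕ} {v : Vertex}

theorem through (r : ℕ) : AtLevel r (through r) :=
  base (.through r)

theorem two_odd : AtLevel 2 odd :=
  base odd

theorem up (h : AtLevel n v) : AtLevel (n + 1) v.up := by
  induction h with
  | base v =>
    cases v with
    | through r => exact through (r + 1)
    | odd => exact (through 1).add_two
  | add_two _ ih => exact ih.add_two

theorem of_up (h : AtLevel n v.up) : AtLevel (n + 1) v := by
  generalize hw : v.up = w at h
  induction h with
  | base w =>
    subst hw
    cases v with
    | through r => exact (through r).add_two
    | odd => exact two_odd
  | add_two _ ih => exact (ih hw).add_two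

theorem base_le (h : AtLevel n v) : v.base ≤ n := by
  induction h with
  | base => rfl
  | add_two _ ih => omega

theorem rank_le (h : AtLevel n v) : v.rank ≤ n :=
  le_trans (by cases v <;> simp [rank, Vertex.base]) h.base_le

theorem mod_two_eq (h : AtLevel n v) : n % 2 = v.rank % 2 := by
  induction h with
  | base v => cases v <;> rfl
  | add_two _ ih => omega

end AtLevel

end Vertex

open Vertex

/-- Walks of length `n` from `through 0` to `v` in the branching graph. -/
inductive Path : ℕ → Vertex → Type
  | nil : Path 0 (through 0)
  | up {n : ℕ} {v : Vertex} (p : Path n v) : Path (n + 1) v.up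
  | down {n : ℕ} {v : Vertex} (p : Path n v.up) : Path (n + 1) v

namespace Path

theorem atLevel {n : ℕ} {v : Vertex} (p : Path n v) : AtLevel n v := by
  induction p with
  | nil => exact .through 0
  | up _ ih => exact ih.up
  | down _ ih => exact ih.of_up

instance (w : Vertex) : Finite {v : Vertex // v.up = w} :=
  Set.Finite.to_subtype <| (Set.toFinite {odd, through (w.rank - 1)}).subset <| by
    rintro v rfl
    cases v <;> simp [rank, Vertex.up]

instance (n : ℕ) (w : Vertex) : Finite (Path n w) := by
  induction n generalizing w with
  | zero => exact Finite.of_injective (fun _ => ()) fun p q _ => by cases p; cases q; rfl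
  | succ n ih =>
    let step : (Σ v : {v : Vertex // v.up = w}, Path n v) ⊕ Path n w.up → Path (n + 1) w
      | .inl ⟨⟨_, h⟩, p⟩ => h ▸ p.up
      | .inr p => p.down
    refine Finite.of_surjective step fun p => ?_
    cases p with
    | up p => exact ⟨.inl ⟨⟨_, rfl⟩, p⟩, rfl⟩
    | down p => exact ⟨.inr p, rfl⟩

noncomputable instance (n : ℕ) (w : Vertex) : Fintype (Path n w) :=
  Fintype.ofFinite _

end Path

section Monomials

variable {A : Type*} [Ring A] (b : ℕ → A) {n : ℕ} {v : Vertex}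

/-- The monomial at level `n` of the diagram whose through strands come first, followed by adjacent
cups and caps. At the vertex `odd` the leftmost cup and cap carry a decoration each. -/
def core (n : ℕ) (v : Vertex) : A :=
  if n ≤ v.base then if v = odd then b 0 else 1 else b (n - 1) * core (n - 2) v
termination_by n
decreasing_by omega

@[simp]
theorem core_through (r : ℕ) : core b r (through r) = 1 := by
  simp [core, base]

@[simp]
theorem core_two_odd : core b 2 odd = b 0 := by
  simp [core, base]

theorem core_add_two (h : AtLevel n v) : core b (n + 2) v = b (n + 1) * core b n v := by
  rw [core, if_neg (by have := h.base_le; omega), Nat.add_sub_cancel]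
  rfl

/-- The product of the core monomials at the vertices of a walk other than the last one. -/
def Path.prod : ∀ {n : ℕ} {v : Vertex}, Path n v → A
  | _, _, .nil => 1
  | n + 1, _, .up (v := v) p => p.prod * core b n v
  | n + 1, v, .down p => p.prod * core b n v.up

theorem Path.prod_up (p : Path n v) : p.up.prod b = p.prod b * core b n v :=
  rfl

theorem Path.prod_down (p : Path n v.up) : p.down.prod b = p.prod b * core b n v.up :=
  rfl

theorem Path.exists_prod_eq_one (v : Vertex) : ∃ p : Path v.base v, p.prod b = 1 := by
  have through_case (r : ℕ) : ∃ p : Path r (through r), p.prod b = 1 := by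
    induction r with
    | zero => exact ⟨.nil, rfl⟩
    | succ r ih =>
      obtain ⟨p, hp⟩ := ih
      exact ⟨p.up, show p.prod b * core b r (through r) = 1 by rw [hp, core_through, one_mul]⟩
  cases v with
  | through r => exact through_case r
  | odd =>
    obtain ⟨p, hp⟩ := through_case 1
    exact ⟨.down (v := odd) p,
      show p.prod b * core b 1 (through 1) = 1 by rw [hp, core_through, one_mul]⟩

end Monomials

/-! ### The tower of algebras -/

/-- The edges `i < j` of the Coxeter graph of type `D`, with `0` in the role of `1̄`. -/
def Joined (i j : ℕ) : Prop :=
  (1 ≤ i ∧ j = i + 1) ∨ (i = 0 ∧ j = 2)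

theorem Joined.lt {i j : ℕ} (h : Joined i j) : i < j := by
  unfold Joined at h
  omega

/-- The defining relations of the pair-free Temperley–Lieb algebra of type `D_N` with parameter `δ`.
The sequence `b` is indexed by `ℕ`, but only its first `N` terms matter. -/
structure PairFreeRelations {R A : Type*} [CommRing R] [Ring A] [Algebra R A] (δ : R) (N : ℕ)
    (b : ℕ → A) : Prop where
  mul_self : ∀ i < N, b i * b i = δ • b i
  commute : ∀ i j, i < j → j < N → ¬ Joined i j → Commute (b i) (b j)
  braid : ∀ i j, Joined i j → j < N → b i * b j * b i = b i
  braid' : ∀ i j, Joined i j → j < N → b j * b i * b j = b j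
  pair : 1 < N → b 1 * b 0 = 0

section Tower

open Submodule

variable {R A : Type*} [CommRing R] [Ring A] [Algebra R A] {b : ℕ → A} {n m r i j : ℕ}
  {v w : Vertex}

variable (R b) in
/-- The line spanned by a generator. -/
abbrev genSpan (i : ℕ) : Submodule R A :=
  R ∙ b i

variable (R b) in
/-- The line spanned by a core monomial. -/
abbrev coreSpan (n : ℕ) (v : Vertex) : Submodule R A :=
  R ∙ core b n v

variable (R b) in
/-- The span of the monomials attached to the walks to a vertex. -/
def walkSpan (n : ℕ) (v : Vertex) : Submodule R A :=
  span R (Set.range fun p : Path n v => p.prod b)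

variable (R b) in
/-- The underlying module of the subalgebra generated by the generators that live on the first `n`
strands; `b 0` lives on the first two strands. -/
def level (n : ℕ) : Submodule R A :=
  Subalgebra.toSubmodule (Algebra.adjoin R (b '' {i | max i 1 < n}))

variable (R b) in
/-- The sum of the two-sided ideals of level `n` generated by the core monomials with fewer than `r`
through strands. -/
def lower (n r : ℕ) : Submodule R A :=
  ⨆ w, ⨆ _ : AtLevel n w ∧ w.rank < r, level R b n * coreSpan R b n w * level R b n

local notation "𝓑" => genSpan R b
local notation "𝓔" => coreSpan R b
local notation "𝓦" => walkSpan R b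
local notation "𝓛" => level R b
local notation "𝓘" => lower R b

theorem one_le_level : 1 ≤ 𝓛 n :=
  Submodule.one_le.2 (one_mem (Algebra.adjoin R _))

theorem level_mul_level : 𝓛 n * 𝓛 n = 𝓛 n :=
  Subalgebra.isIdempotentElem_toSubmodule _

theorem mul_le_level {P Q : Submodule R A} (hP : P ≤ 𝓛 n) (hQ : Q ≤ 𝓛 n) : P * Q ≤ 𝓛 n :=
  (mul_le_mul' hP hQ).trans_eq level_mul_level

theorem level_mono (h : m ≤ n) : 𝓛 m ≤ 𝓛 n :=
  Algebra.adjoin_mono (Set.image_mono fun _ hi => lt_of_lt_of_le hi h)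

theorem genSpan_le_level (h : max i 1 < n) : 𝓑 i ≤ 𝓛 n :=
  (span_singleton_le_iff_mem _ _).2 (Algebra.subset_adjoin ⟨i, h, rfl⟩)

theorem level_le {Q : Submodule R A} (h1 : 1 ≤ Q) (hmul : ∀ i, max i 1 < n → 𝓑 i * Q ≤ Q) :
    𝓛 n ≤ Q := by
  suffices h : ∀ x ∈ 𝓛 n, ∀ q ∈ Q, x * q ∈ Q from
    fun x hx => by simpa using h x hx 1 (Submodule.one_le.1 h1)
  intro x (hx : x ∈ Algebra.adjoin R _)
  induction hx using Algebra.adjoin_induction with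
  | mem g hg =>
    obtain ⟨i, hi, rfl⟩ := hg
    exact fun q hq => hmul i hi (mul_mem_mul (mem_span_singleton_self _) hq)
  | algebraMap r => intro q hq; rw [← Algebra.smul_def]; exact Q.smul_mem r hq
  | add x y _ _ hx hy => intro q hq; rw [add_mul]; exact Q.add_mem (hx q hq) (hy q hq)
  | mul x y _ _ hx hy => intro q hq; rw [mul_assoc]; exact hx _ (hy q hq)

theorem level_le_one (hn : n ≤ 1) : 𝓛 n ≤ 1 :=
  level_le le_rfl fun _ hi => by omega

theorem coreSpan_add_two (h : AtLevel n v) : 𝓔 (n + 2) v = 𝓑 (n + 1) * 𝓔 n v := by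
  rw [coreSpan, core_add_two b h, span_mul_span, Set.singleton_mul_singleton]

theorem coreSpan_through : 𝓔 r (through r) = 1 := by
  rw [coreSpan, core_through, one_eq_span]

theorem coreSpan_two_odd : 𝓔 2 odd = 𝓑 0 := by
  rw [coreSpan, core_two_odd]

theorem coreSpan_le_level (h : AtLevel n v) : 𝓔 n v ≤ 𝓛 n := by
  induction h with
  | base v =>
    cases v with
    | through r => exact coreSpan_through.trans_le one_le_level
    | odd => exact coreSpan_two_odd.trans_le (genSpan_le_level one_lt_two)
  | @add_two n v h ih =>
    rw [coreSpan_add_two h]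
    exact mul_le_level (genSpan_le_level (by omega)) (ih.trans (level_mono (by omega)))

theorem walkSpan_le_level : 𝓦 n v ≤ 𝓛 n := by
  refine span_le.2 ?_
  rintro _ ⟨p, rfl⟩
  change p.prod b ∈ 𝓛 n
  induction p with
  | nil => exact Submodule.one_le.1 one_le_level
  | up p ih | down p ih =>
    refine level_mono (Nat.le_succ _) (level_mul_level.le (mul_mem_mul ih ?_))
    exact coreSpan_le_level p.atLevel (mem_span_singleton_self _)

theorem one_le_walkSpan : 1 ≤ 𝓦 v.base v := by
  obtain ⟨p, hp⟩ := Path.exists_prod_eq_one b v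
  exact Submodule.one_le.2 (subset_span ⟨p, hp⟩)

theorem walkSpan_mul_coreSpan_le_up : 𝓦 n v * 𝓔 n v ≤ 𝓦 (n + 1) v.up := by
  rw [walkSpan, span_mul_span, span_le]
  rintro _ ⟨_, ⟨p, rfl⟩, _, rfl, rfl⟩
  exact subset_span ⟨p.up, rfl⟩

theorem walkSpan_mul_coreSpan_le_down : 𝓦 n v.up * 𝓔 n v.up ≤ 𝓦 (n + 1) v := by
  rw [walkSpan, span_mul_span, span_le]
  rintro _ ⟨_, ⟨p, rfl⟩, _, rfl, rfl⟩
  exact subset_span ⟨p.down, rfl⟩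

theorem mul_coreSpan_mul_le_lower (hw : AtLevel n w) (hr : w.rank < r) :
    𝓛 n * 𝓔 n w * 𝓛 n ≤ 𝓘 n r :=
  le_iSup₂_of_le w ⟨hw, hr⟩ le_rfl

theorem lower_le {Q : Submodule R A}
    (h : ∀ w, AtLevel n w → w.rank < r → 𝓛 n * 𝓔 n w * 𝓛 n ≤ Q) : 𝓘 n r ≤ Q :=
  iSup₂_le fun w hw => h w hw.1 hw.2

theorem lower_mul_le {P Q : Submodule R A}
    (h : ∀ w, AtLevel n w → w.rank < r → 𝓛 n * 𝓔 n w * 𝓛 n * P ≤ Q) : 𝓘 n r * P ≤ Q := by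
  simp only [lower, iSup_mul]
  exact iSup₂_le fun w hw => h w hw.1 hw.2

theorem lower_mono (h : m ≤ r) : 𝓘 n m ≤ 𝓘 n r :=
  lower_le fun _ hw hr => mul_coreSpan_mul_le_lower hw (hr.trans_le h)

theorem coreSpan_le_lower (hw : AtLevel n w) (hr : w.rank < r) : 𝓔 n w ≤ 𝓘 n r :=
  calc 𝓔 n w = 1 * 𝓔 n w * 1 := by rw [one_mul, mul_one]
    _ ≤ 𝓛 n * 𝓔 n w * 𝓛 n := by gcongr <;> exact one_le_level
    _ ≤ 𝓘 n r := mul_coreSpan_mul_le_lower hw hr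

theorem lower_mul_level_le : 𝓘 n r * 𝓛 n ≤ 𝓘 n r :=
  lower_mul_le fun w hw hr => by
    rw [mul_assoc, level_mul_level]
    exact mul_coreSpan_mul_le_lower hw hr

theorem level_mul_lower_le : 𝓛 n * 𝓘 n r ≤ 𝓘 n r := by
  conv_lhs => simp only [lower, mul_iSup]
  refine iSup₂_le fun w hw => ?_
  rw [← mul_assoc, ← mul_assoc, level_mul_level]
  exact mul_coreSpan_mul_le_lower hw.1 hw.2

theorem level_succ_le (hn : 2 ≤ n) (hsandwich : 𝓑 n * 𝓛 n * 𝓑 n ≤ 𝓛 n * 𝓑 n) :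
    𝓛 (n + 1) ≤ 𝓛 n ⊔ 𝓛 n * 𝓑 n * 𝓛 n := by
  refine level_le (one_le_level.trans le_sup_left) fun i hi => ?_
  rw [Submodule.mul_sup, ← mul_assoc, ← mul_assoc]
  obtain rfl | hi : i = n ∨ max i 1 < n := by omega
  · refine sup_le (le_sup_of_le_right ?_) (le_sup_of_le_right ?_)
    · exact mul_le_mul_left (le_mul_of_one_le_left' one_le_level) _
    · exact mul_le_mul_left hsandwich _
  · have h : 𝓑 i * 𝓛 n ≤ 𝓛 n := mul_le_level (genSpan_le_level hi) le_rfl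
    gcongr

namespace PairFreeRelations

variable {δ : R} {N : ℕ}

theorem genSpan_mul_self_le (hb : PairFreeRelations δ N b) (hi : i < N) : 𝓑 i * 𝓑 i ≤ 𝓑 i := by
  rw [span_mul_span, Set.singleton_mul_singleton, hb.mul_self i hi]
  exact span_singleton_smul_le R δ (b i)

theorem genSpan_braid (hb : PairFreeRelations δ N b) (h : Joined i j) (hj : j < N) :
    𝓑 i * 𝓑 j * 𝓑 i = 𝓑 i := by
  simp only [span_mul_span, Set.singleton_mul_singleton, hb.braid i j h hj]

theorem genSpan_braid' (hb : PairFreeRelations δ N b) (h : Joined i j) (hj : j < N) :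
    𝓑 j * 𝓑 i * 𝓑 j = 𝓑 j := by
  simp only [span_mul_span, Set.singleton_mul_singleton, hb.braid' i j h hj]

theorem zero_mul_one (hb : PairFreeRelations δ N b) (hN : 1 < N) : b 0 * b 1 = 0 := by
  rw [hb.commute 0 1 one_pos hN (by simp [Joined]), hb.pair hN]

theorem genSpan_one_mul_zero (hb : PairFreeRelations δ N b) (hN : 1 < N) : 𝓑 1 * 𝓑 0 = ⊥ := by
  rw [span_mul_span, Set.singleton_mul_singleton, hb.pair hN, span_zero_singleton]

theorem genSpan_zero_mul_one (hb : PairFreeRelations δ N b) (hN : 1 < N) : 𝓑 0 * 𝓑 1 = ⊥ := by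
  rw [span_mul_span, Set.singleton_mul_singleton, hb.zero_mul_one hN, span_zero_singleton]

theorem commute_of_mem_level (hb : PairFreeRelations δ N b) {x : A} (hx : x ∈ 𝓛 n) (hn : n < m)
    (hm : m < N) : Commute x (b m) := by
  have hcentral : Algebra.adjoin R (b '' {i | max i 1 < n}) ≤ Subalgebra.centralizer R {b m} := by
    refine Algebra.adjoin_le ?_
    rintro _ ⟨i, hi : max i 1 < n, rfl⟩
    rw [SetLike.mem_coe, Subalgebra.mem_centralizer_iff]
    rintro _ rfl
    exact (hb.commute i m (by omega) hm (by unfold Joined; omega)).eq.symm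
  exact ((Subalgebra.mem_centralizer_iff R).1 (hcentral hx) _ rfl).symm

theorem commute_genSpan (hb : PairFreeRelations δ N b) {P : Submodule R A} (hP : P ≤ 𝓛 n)
    (hn : n < m) (hm : m < N) : Commute P (𝓑 m) := by
  ext y
  rw [mem_mul_span_singleton, mem_span_singleton_mul]
  exact exists_congr fun x => and_congr_right fun hx => by
    rw [hb.commute_of_mem_level (hP hx) hn hm]

theorem level_two_le (hb : PairFreeRelations δ N b) (hN : 2 ≤ N) : 𝓛 2 ≤ 1 ⊔ 𝓑 0 ⊔ 𝓑 1 := by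
  refine level_le (le_sup_left.trans le_sup_left) fun i hi => ?_
  simp only [Submodule.mul_sup, mul_one]
  obtain rfl | rfl : i = 0 ∨ i = 1 := by omega
  · rw [hb.genSpan_zero_mul_one hN, sup_bot_eq, sup_eq_left.2 (hb.genSpan_mul_self_le (by omega))]
    exact le_sup_right.trans le_sup_left
  · rw [hb.genSpan_one_mul_zero hN, sup_bot_eq, sup_eq_left.2 (hb.genSpan_mul_self_le (by omega))]
    exact le_sup_right

theorem sandwich_level_two (hb : PairFreeRelations δ N b) (hN : 2 < N) :
    𝓑 2 * 𝓛 2 * 𝓑 2 ≤ 𝓑 2 :=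
  calc 𝓑 2 * 𝓛 2 * 𝓑 2 ≤ 𝓑 2 * (1 ⊔ 𝓑 0 ⊔ 𝓑 1) * 𝓑 2 := by
        gcongr; exact hb.level_two_le hN.le
    _ = 𝓑 2 * 𝓑 2 ⊔ 𝓑 2 * 𝓑 0 * 𝓑 2 ⊔ 𝓑 2 * 𝓑 1 * 𝓑 2 := by
        simp only [Submodule.mul_sup, Submodule.sup_mul, mul_one]
    _ ≤ 𝓑 2 := sup_le (sup_le (hb.genSpan_mul_self_le hN)
        (hb.genSpan_braid' (.inr ⟨rfl, rfl⟩) hN).le) (hb.genSpan_braid' (.inl ⟨le_rfl, rfl⟩) hN).le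

theorem sandwich_of_level_succ_le (hb : PairFreeRelations δ N b) (hn : 1 ≤ n) (hN : n + 1 < N)
    (h : 𝓛 (n + 1) ≤ 𝓛 n ⊔ 𝓛 n * 𝓑 n * 𝓛 n) :
    𝓑 (n + 1) * 𝓛 (n + 1) * 𝓑 (n + 1) ≤ 𝓛 n * 𝓑 (n + 1) := by
  have hcomm : 𝓛 n * 𝓑 (n + 1) = 𝓑 (n + 1) * 𝓛 n := hb.commute_genSpan le_rfl n.lt_succ_self hN
  calc 𝓑 (n + 1) * 𝓛 (n + 1) * 𝓑 (n + 1)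
      ≤ 𝓑 (n + 1) * (𝓛 n ⊔ 𝓛 n * 𝓑 n * 𝓛 n) * 𝓑 (n + 1) := by gcongr
    _ = 𝓑 (n + 1) * 𝓛 n * 𝓑 (n + 1) ⊔ 𝓑 (n + 1) * 𝓛 n * 𝓑 n * (𝓛 n * 𝓑 (n + 1)) := by
        simp only [Submodule.mul_sup, Submodule.sup_mul, mul_assoc]
    _ = 𝓛 n * (𝓑 (n + 1) * 𝓑 (n + 1)) ⊔ 𝓛 n * (𝓑 (n + 1) * 𝓑 n * 𝓑 (n + 1)) * 𝓛 n := by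
        rw [hcomm, mul_assoc _ (𝓑 n), ← mul_assoc (𝓑 n), ← hcomm]
        simp only [mul_assoc]
    _ = 𝓛 n * (𝓑 (n + 1) * 𝓑 (n + 1)) ⊔ 𝓛 n * 𝓑 (n + 1) := by
        rw [hb.genSpan_braid' (.inl ⟨hn, rfl⟩) hN, mul_assoc _ (𝓑 (n + 1)) (𝓛 n), ← hcomm,
          ← mul_assoc (𝓛 n) (𝓛 n), level_mul_level]
    _ ≤ 𝓛 n * 𝓑 (n + 1) := sup_le (mul_le_mul_right (hb.genSpan_mul_self_le hN) _) le_rfl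

theorem sandwich (hb : PairFreeRelations δ N b) (n : ℕ) (hn : n + 1 < N) :
    𝓑 (n + 1) * 𝓛 (n + 1) * 𝓑 (n + 1) ≤ 𝓛 n * 𝓑 (n + 1) := by
  induction n with
  | zero =>
    calc 𝓑 1 * 𝓛 1 * 𝓑 1 ≤ 𝓑 1 * 1 * 𝓑 1 := by gcongr; exact level_le_one le_rfl
      _ ≤ 𝓑 1 := by rw [mul_one]; exact hb.genSpan_mul_self_le hn
      _ ≤ 𝓛 0 * 𝓑 1 := le_mul_of_one_le_left' one_le_level
  | succ n ih =>
    rcases n.eq_zero_or_pos with rfl | hpos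
    · exact (hb.sandwich_level_two hn).trans (le_mul_of_one_le_left' one_le_level)
    · refine hb.sandwich_of_level_succ_le (by omega) hn (level_succ_le (by omega) ?_)
      exact (ih (by omega)).trans (mul_le_mul_left (level_mono n.le_succ) _)

theorem level_add_two_mul_genSpan_le (hb : PairFreeRelations δ N b) (hn : n + 1 < N) :
    𝓛 (n + 2) * 𝓑 (n + 1) ≤ 𝓛 (n + 1) * 𝓑 (n + 1) := by
  rcases n.eq_zero_or_pos with rfl | hpos
  · calc 𝓛 2 * 𝓑 1 ≤ (1 ⊔ 𝓑 0 ⊔ 𝓑 1) * 𝓑 1 := by gcongr; exact hb.level_two_le hn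
      _ = 𝓑 1 ⊔ 𝓑 1 * 𝓑 1 := by
          rw [Submodule.sup_mul, Submodule.sup_mul, one_mul, hb.genSpan_zero_mul_one hn, sup_bot_eq]
      _ ≤ 𝓑 1 := sup_le le_rfl (hb.genSpan_mul_self_le hn)
      _ ≤ 𝓛 1 * 𝓑 1 := le_mul_of_one_le_left' one_le_level
  · have hsandwich : 𝓑 (n + 1) * 𝓛 (n + 1) * 𝓑 (n + 1) ≤ 𝓛 (n + 1) * 𝓑 (n + 1) :=
      (hb.sandwich n hn).trans (mul_le_mul_left (level_mono n.le_succ) _)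
    calc 𝓛 (n + 2) * 𝓑 (n + 1)
        ≤ (𝓛 (n + 1) ⊔ 𝓛 (n + 1) * 𝓑 (n + 1) * 𝓛 (n + 1)) * 𝓑 (n + 1) := by
          gcongr; exact level_succ_le (by omega) hsandwich
      _ = 𝓛 (n + 1) * 𝓑 (n + 1) ⊔ 𝓛 (n + 1) * (𝓑 (n + 1) * 𝓛 (n + 1) * 𝓑 (n + 1)) := by
          simp only [Submodule.sup_mul, mul_assoc]
      _ ≤ 𝓛 (n + 1) * 𝓑 (n + 1) := by
          refine sup_le le_rfl ((mul_le_mul_right hsandwich _).trans ?_)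
          rw [← mul_assoc, level_mul_level]

theorem sandwich_level_add_two (hb : PairFreeRelations δ N b) (hn : n + 1 < N) :
    𝓑 (n + 1) * 𝓛 (n + 2) * 𝓑 (n + 1) ≤ 𝓛 n * 𝓑 (n + 1) :=
  calc 𝓑 (n + 1) * 𝓛 (n + 2) * 𝓑 (n + 1) ≤ 𝓑 (n + 1) * (𝓛 (n + 1) * 𝓑 (n + 1)) := by
        rw [mul_assoc]; exact mul_le_mul_right (hb.level_add_two_mul_genSpan_le hn) _
    _ ≤ 𝓛 n * 𝓑 (n + 1) := by rw [← mul_assoc]; exact hb.sandwich n hn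

theorem coreSpan_mul_up_mul_self (hb : PairFreeRelations δ N b) (h : AtLevel n v) (hn : n < N) :
    𝓔 n v * 𝓔 (n + 1) v.up * 𝓔 n v = 𝓔 n v := by
  induction h with
  | base v =>
    cases v with
    | through r => simp only [base, Vertex.up, coreSpan_through, one_mul]
    | odd =>
      have h3 : 𝓔 3 (through 1) = 𝓑 2 * 1 := by
        rw [coreSpan_add_two (.through 1), coreSpan_through]
      change 𝓔 2 odd * 𝓔 3 (through 1) * 𝓔 2 odd = 𝓔 2 odd
      rw [h3, mul_one, coreSpan_two_odd, hb.genSpan_braid (.inr ⟨rfl, rfl⟩) hn]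
  | @add_two n v hv ih =>
    have h1 : 𝓔 n v * 𝓑 (n + 1) = 𝓑 (n + 1) * 𝓔 n v :=
      hb.commute_genSpan (coreSpan_le_level hv) (by omega) (by omega)
    have h2 : 𝓔 n v * 𝓑 (n + 2) = 𝓑 (n + 2) * 𝓔 n v :=
      hb.commute_genSpan (coreSpan_le_level hv) (by omega) hn
    calc 𝓔 (n + 2) v * 𝓔 (n + 1 + 2) v.up * 𝓔 (n + 2) v
        = 𝓑 (n + 1) * (𝓔 n v * 𝓑 (n + 2)) * 𝓔 (n + 1) v.up * (𝓑 (n + 1) * 𝓔 n v) := by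
          rw [coreSpan_add_two hv, coreSpan_add_two hv.up]; simp only [mul_assoc]
      _ = 𝓑 (n + 1) * 𝓑 (n + 2) * (𝓔 n v * 𝓔 (n + 1) v.up * 𝓔 n v) * 𝓑 (n + 1) := by
          rw [h2, ← h1]; simp only [mul_assoc]
      _ = 𝓑 (n + 1) * 𝓑 (n + 2) * 𝓑 (n + 1) * 𝓔 n v := by
          rw [ih (by omega), mul_assoc, h1, ← mul_assoc]
      _ = 𝓔 (n + 2) v := by
          rw [hb.genSpan_braid (.inl ⟨by omega, rfl⟩) hn, coreSpan_add_two hv]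

theorem lower_le_lower_succ (hb : PairFreeRelations δ N b) (hn : n < N) :
    𝓘 n r ≤ 𝓘 (n + 1) (r + 1) := by
  refine lower_le fun w hw hr => ?_
  have hcore : 𝓔 n w ≤ 𝓛 n := coreSpan_le_level hw
  calc 𝓛 n * 𝓔 n w * 𝓛 n = (𝓛 n * 𝓔 n w) * 𝓔 (n + 1) w.up * (𝓔 n w * 𝓛 n) := by
        conv_lhs => rw [← hb.coreSpan_mul_up_mul_self hw hn]
        simp only [mul_assoc]
    _ ≤ 𝓛 (n + 1) * 𝓔 (n + 1) w.up * 𝓛 (n + 1) := by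
        gcongr
        · exact (mul_le_level le_rfl hcore).trans (level_mono n.le_succ)
        · exact (mul_le_level hcore le_rfl).trans (level_mono n.le_succ)
    _ ≤ 𝓘 (n + 1) (r + 1) := mul_coreSpan_mul_le_lower hw.up (by rw [rank_up]; omega)

theorem genSpan_le_lower (hb : PairFreeRelations δ N b) (hi : max i 1 < n) (hn : n ≤ N) :
    𝓑 i ≤ 𝓘 n n := by
  induction n, hi using Nat.le_induction with
  | base =>
    rcases i with _ | i
    · exact coreSpan_two_odd.symm.trans_le (coreSpan_le_lower .two_odd two_pos)
    · have hcore : 𝓔 (i + 2) (through i) = 𝓑 (i + 1) := by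
        rw [coreSpan_add_two (.through i), coreSpan_through, mul_one]
      rw [max_eq_left (by omega)]
      exact hcore.symm.trans_le
        (coreSpan_le_lower (AtLevel.through i).add_two (Nat.lt_add_of_pos_right two_pos))
  | succ n _ ih => exact (ih (by omega)).trans (hb.lower_le_lower_succ hn)

theorem level_le_one_sup_lower (hb : PairFreeRelations δ N b) (hn : n ≤ N) :
    𝓛 n ≤ 1 ⊔ 𝓘 n n := by
  refine level_le le_sup_left fun i hi => ?_
  rw [Submodule.mul_sup, mul_one]
  exact le_sup_of_le_right <| sup_le (hb.genSpan_le_lower hi hn) <|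
    (mul_le_mul_left (genSpan_le_level hi) _).trans level_mul_lower_le

theorem level_base_mul_coreSpan_le (hb : PairFreeRelations δ N b) (hv : v.base ≤ N) :
    𝓛 v.base * 𝓔 v.base v ≤ 𝓔 v.base v ⊔ 𝓘 v.base v.rank := by
  cases v with
  | through r =>
    rw [base, coreSpan_through, mul_one]
    exact hb.level_le_one_sup_lower hv
  | odd =>
    refine le_sup_of_le_left ?_
    change 𝓛 2 * 𝓔 2 odd ≤ 𝓔 2 odd
    calc 𝓛 2 * 𝓔 2 odd ≤ (1 ⊔ 𝓑 0 ⊔ 𝓑 1) * 𝓔 2 odd := by gcongr; exact hb.level_two_le hv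
      _ = 𝓑 0 ⊔ 𝓑 0 * 𝓑 0 := by
          rw [coreSpan_two_odd, Submodule.sup_mul, Submodule.sup_mul, one_mul,
            hb.genSpan_one_mul_zero hv, sup_bot_eq]
      _ ≤ 𝓔 2 odd := by
          rw [coreSpan_two_odd]
          exact sup_le le_rfl (hb.genSpan_mul_self_le (zero_lt_two.trans_le hv))

theorem lower_mul_genSpan_le (hb : PairFreeRelations δ N b) (hn : n + 1 < N) :
    𝓘 n r * 𝓑 (n + 1) ≤ 𝓘 (n + 2) r := by
  have hmono : 𝓛 n ≤ 𝓛 (n + 2) := level_mono (Nat.le_add_right n 2)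
  refine lower_mul_le fun w hw hr => ?_
  calc 𝓛 n * 𝓔 n w * 𝓛 n * 𝓑 (n + 1) = 𝓛 n * 𝓔 (n + 2) w * 𝓛 n := by
        rw [coreSpan_add_two hw, mul_assoc _ (𝓛 n), hb.commute_genSpan le_rfl n.lt_succ_self hn,
          ← mul_assoc, mul_assoc _ (𝓔 n w),
          hb.commute_genSpan (coreSpan_le_level hw) n.lt_succ_self hn]
    _ ≤ 𝓛 (n + 2) * 𝓔 (n + 2) w * 𝓛 (n + 2) := by gcongr
    _ ≤ 𝓘 (n + 2) r := mul_coreSpan_mul_le_lower hw.add_two hr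

theorem coreSpan_sandwich_le (hb : PairFreeRelations δ N b) (h : AtLevel n v) (hn : n ≤ N) :
    𝓔 n v * 𝓛 n * 𝓔 n v ≤ 𝓔 n v ⊔ 𝓘 n v.rank := by
  induction h with
  | base v =>
    refine le_trans ?_ (hb.level_base_mul_coreSpan_le hn)
    gcongr
    exact mul_le_level (coreSpan_le_level (.base v)) le_rfl
  | @add_two n v hv ih =>
    have hcomm : 𝓔 n v * 𝓑 (n + 1) = 𝓑 (n + 1) * 𝓔 n v :=
      hb.commute_genSpan (coreSpan_le_level hv) n.lt_succ_self hn
    calc 𝓔 (n + 2) v * 𝓛 (n + 2) * 𝓔 (n + 2) v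
        = 𝓔 n v * (𝓑 (n + 1) * 𝓛 (n + 2) * 𝓑 (n + 1)) * 𝓔 n v := by
          rw [coreSpan_add_two hv]
          nth_rw 1 [← hcomm]
          simp only [mul_assoc]
      _ ≤ 𝓔 n v * (𝓛 n * 𝓑 (n + 1)) * 𝓔 n v := by
          gcongr 𝓔 n v * ?_ * 𝓔 n v; exact hb.sandwich_level_add_two hn
      _ = 𝓔 n v * 𝓛 n * 𝓔 n v * 𝓑 (n + 1) := by simp only [mul_assoc, hcomm]
      _ ≤ (𝓔 n v ⊔ 𝓘 n v.rank) * 𝓑 (n + 1) := by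
          gcongr ?_ * 𝓑 (n + 1); exact ih (by omega)
      _ = 𝓔 (n + 2) v ⊔ 𝓘 n v.rank * 𝓑 (n + 1) := by
          rw [Submodule.sup_mul, hcomm, coreSpan_add_two hv]
      _ ≤ 𝓔 (n + 2) v ⊔ 𝓘 (n + 2) v.rank :=
          sup_le_sup_left (hb.lower_mul_genSpan_le hn) _

theorem lower_mul_coreSpan_le (hb : PairFreeRelations δ N b) (hv : AtLevel (n + 1) v) (hn : n < N)
    (hr : r < v.rank) : 𝓘 n r * 𝓔 (n + 1) v ≤ 𝓘 (n + 1) v.rank :=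
  calc 𝓘 n r * 𝓔 (n + 1) v ≤ 𝓘 (n + 1) (r + 1) * 𝓛 (n + 1) :=
        mul_le_mul' (hb.lower_le_lower_succ hn) (coreSpan_le_level hv)
    _ ≤ 𝓘 (n + 1) (r + 1) := lower_mul_level_le
    _ ≤ 𝓘 (n + 1) v.rank := lower_mono hr

theorem walkSpan_mul_coreSpan_mul_up_le (hb : PairFreeRelations δ N b) (hw : AtLevel n w)
    (hn : n < N) : 𝓦 n w * 𝓔 n w * 𝓛 n * 𝓔 (n + 1) w.up ≤
      𝓦 (n + 1) w.up * 𝓔 (n + 1) w.up ⊔ 𝓘 (n + 1) w.up.rank := by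
  have hmid : 𝓔 n w * 𝓛 n ≤ 𝓛 (n + 1) :=
    (mul_le_level (coreSpan_le_level hw) le_rfl).trans (level_mono n.le_succ)
  have hleft : 𝓦 n w * 𝓔 n w ≤ 𝓛 (n + 1) :=
    (mul_le_level walkSpan_le_level (coreSpan_le_level hw)).trans (level_mono n.le_succ)
  calc 𝓦 n w * 𝓔 n w * 𝓛 n * 𝓔 (n + 1) w.up
      = 𝓦 n w * 𝓔 n w * (𝓔 (n + 1) w.up * (𝓔 n w * 𝓛 n) * 𝓔 (n + 1) w.up) := by
        conv_lhs => rw [← hb.coreSpan_mul_up_mul_self hw hn]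
        simp only [mul_assoc]
    _ ≤ 𝓦 n w * 𝓔 n w * (𝓔 (n + 1) w.up * 𝓛 (n + 1) * 𝓔 (n + 1) w.up) := by
        gcongr 𝓦 n w * 𝓔 n w * (𝓔 (n + 1) w.up * ?_ * 𝓔 (n + 1) w.up)
    _ ≤ 𝓦 n w * 𝓔 n w * (𝓔 (n + 1) w.up ⊔ 𝓘 (n + 1) w.up.rank) :=
        mul_le_mul_right (hb.coreSpan_sandwich_le hw.up hn) _
    _ = 𝓦 n w * 𝓔 n w * 𝓔 (n + 1) w.up ⊔ 𝓦 n w * 𝓔 n w * 𝓘 (n + 1) w.up.rank :=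
        Submodule.mul_sup ..
    _ ≤ 𝓦 (n + 1) w.up * 𝓔 (n + 1) w.up ⊔ 𝓘 (n + 1) w.up.rank :=
        sup_le_sup (mul_le_mul_left walkSpan_mul_coreSpan_le_up _)
          ((mul_le_mul_left hleft _).trans level_mul_lower_le)

theorem ideal_mul_coreSpan_le (hb : PairFreeRelations δ N b) (hn : n < N) (hw : AtLevel n w)
    (hv : AtLevel (n + 1) v) (hr : w.rank < v.rank)
    (ih : 𝓛 n * 𝓔 n w ≤ 𝓦 n w * 𝓔 n w ⊔ 𝓘 n w.rank) :
    𝓛 n * 𝓔 n w * 𝓛 n * 𝓔 (n + 1) v ≤ 𝓦 (n + 1) v * 𝓔 (n + 1) v ⊔ 𝓘 (n + 1) v.rank := by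
  rcases (Nat.succ_le_of_lt hr).lt_or_eq with hlt | heq
  · refine le_sup_of_le_right (le_trans ?_ (hb.lower_mul_coreSpan_le hv hn hlt))
    exact mul_le_mul_left (mul_coreSpan_mul_le_lower hw w.rank.lt_succ_self) _
  obtain rfl : w.up = v := up_eq_of_rank_succ_eq heq
  calc 𝓛 n * 𝓔 n w * 𝓛 n * 𝓔 (n + 1) w.up
      ≤ (𝓦 n w * 𝓔 n w ⊔ 𝓘 n w.rank) * 𝓛 n * 𝓔 (n + 1) w.up := by
        gcongr ?_ * 𝓛 n * 𝓔 (n + 1) w.up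
    _ = 𝓦 n w * 𝓔 n w * 𝓛 n * 𝓔 (n + 1) w.up ⊔ 𝓘 n w.rank * 𝓛 n * 𝓔 (n + 1) w.up := by
        rw [Submodule.sup_mul, Submodule.sup_mul]
    _ ≤ _ := sup_le (hb.walkSpan_mul_coreSpan_mul_up_le hw hn) <| le_sup_of_le_right <|
        (mul_le_mul_left lower_mul_level_le _).trans (hb.lower_mul_coreSpan_le hv hn hr)

theorem level_mul_coreSpan_add_two_le (hb : PairFreeRelations δ N b) (hv : AtLevel n v)
    (hn : n + 1 < N) :
    𝓛 (n + 2) * 𝓔 (n + 2) v ≤ 𝓛 (n + 1) * 𝓔 (n + 1) v.up * 𝓔 (n + 2) v := by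
  have hcore : 𝓔 n v ≤ 𝓛 (n + 1) := (coreSpan_le_level hv).trans (level_mono n.le_succ)
  have hcomm : 𝓑 (n + 1) * 𝓔 n v = 𝓔 n v * 𝓑 (n + 1) :=
    (hb.commute_genSpan (coreSpan_le_level hv) n.lt_succ_self hn).symm
  calc 𝓛 (n + 2) * 𝓔 (n + 2) v = 𝓛 (n + 2) * 𝓑 (n + 1) * 𝓔 n v := by
        rw [coreSpan_add_two hv, mul_assoc]
    _ ≤ 𝓛 (n + 1) * 𝓑 (n + 1) * 𝓔 n v :=
        mul_le_mul_left (hb.level_add_two_mul_genSpan_le hn) _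
    _ = 𝓛 (n + 1) * 𝓔 n v * 𝓔 (n + 1) v.up * 𝓔 (n + 2) v := by
        rw [coreSpan_add_two hv, hcomm, mul_assoc, hcomm]
        conv_lhs => rw [← hb.coreSpan_mul_up_mul_self hv (by omega)]
        simp only [mul_assoc]
    _ ≤ 𝓛 (n + 1) * 𝓔 (n + 1) v.up * 𝓔 (n + 2) v := by
        gcongr ?_ * _ * _
        exact mul_le_level le_rfl hcore

theorem level_mul_coreSpan_le (hb : PairFreeRelations δ N b) (hv : AtLevel n v) (hn : n ≤ N) :
    𝓛 n * 𝓔 n v ≤ 𝓦 n v * 𝓔 n v ⊔ 𝓘 n v.rank := by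
  induction n using Nat.strong_induction_on generalizing v with
  | _ n ih =>
    cases hv with
    | base =>
      refine (hb.level_base_mul_coreSpan_le hn).trans (sup_le_sup_right ?_ _)
      exact le_mul_of_one_le_left' one_le_walkSpan
    | @add_two n _ hv =>
      have hlower : 𝓘 (n + 1) v.up.rank * 𝓔 (n + 2) v ≤
          𝓦 (n + 2) v * 𝓔 (n + 2) v ⊔ 𝓘 (n + 2) v.rank := by
        refine lower_mul_le fun w hw hr => ?_
        have hparity := hw.mod_two_eq
        have hparity' := hv.mod_two_eq
        rw [rank_up] at hr
        exact hb.ideal_mul_coreSpan_le hn hw hv.add_two (by omega)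
          (ih (n + 1) (by omega) hw (by omega))
      calc 𝓛 (n + 2) * 𝓔 (n + 2) v
          ≤ 𝓛 (n + 1) * 𝓔 (n + 1) v.up * 𝓔 (n + 2) v := hb.level_mul_coreSpan_add_two_le hv hn
        _ ≤ (𝓦 (n + 1) v.up * 𝓔 (n + 1) v.up ⊔ 𝓘 (n + 1) v.up.rank) * 𝓔 (n + 2) v :=
            mul_le_mul_left (ih (n + 1) (by omega) hv.up (by omega)) _
        _ = 𝓦 (n + 1) v.up * 𝓔 (n + 1) v.up * 𝓔 (n + 2) v ⊔
              𝓘 (n + 1) v.up.rank * 𝓔 (n + 2) v := Submodule.sup_mul ..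
        _ ≤ 𝓦 (n + 2) v * 𝓔 (n + 2) v ⊔ 𝓘 (n + 2) v.rank :=
            sup_le (le_sup_of_le_left (mul_le_mul_left walkSpan_mul_coreSpan_le_down _)) hlower

end PairFreeRelations

end Tower

/-! ### The cell datum -/

namespace Vertex

/-- Vertices are ordered by the number of through strands; the two vertices of rank zero are
incomparable. -/
instance : PartialOrder Vertex where
  le v w := v = w ∨ v.rank < w.rank
  le_refl _ := .inl rfl
  le_trans := by grind
  le_antisymm := by grind

theorem lt_iff_rank_lt {v w : Vertex} : v < w ↔ v.rank < w.rank := by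
  rw [lt_iff_le_and_ne]
  change (v = w ∨ v.rank < w.rank) ∧ v ≠ w ↔ v.rank < w.rank
  grind

end Vertex

section Cell

open Submodule

variable {R A : Type*} [CommRing R] [Ring A] [Algebra R A] {σ : A →ₗ[R] A} {b : ℕ → A} {δ : R}
  {N n r : ℕ} {v : Vertex}

/-- A linear involutory anti-automorphism fixing the first `N` terms of `b`: it reads the products
of generators backwards. -/
structure IsReversal (σ : A →ₗ[R] A) (b : ℕ → A) (N : ℕ) : Prop where
  involutive : Function.Involutive σ
  map_mul : ∀ x y, σ (x * y) = σ y * σ x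
  map_gen : ∀ i < N, σ (b i) = b i

namespace IsReversal

theorem map_one (hσ : IsReversal σ b N) : σ 1 = 1 := by
  simpa [hσ.involutive 1] using (hσ.map_mul (σ 1) 1).symm

theorem submodule_map_mul (hσ : IsReversal σ b N) (P Q : Submodule R A) :
    (P * Q).map σ = Q.map σ * P.map σ := by
  refine le_antisymm (map_le_iff_le_comap.2 <| mul_le.2 fun p hp q hq => ?_) (mul_le.2 ?_)
  · rw [mem_comap, hσ.map_mul]
    exact mul_mem_mul (mem_map_of_mem hq) (mem_map_of_mem hp)
  · rintro _ ⟨q, hq, rfl⟩ _ ⟨p, hp, rfl⟩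
    exact hσ.map_mul p q ▸ mem_map_of_mem (mul_mem_mul hp hq)

theorem submodule_map_top (hσ : IsReversal σ b N) : (⊤ : Submodule R A).map σ = ⊤ := by
  rw [Submodule.map_top, LinearMap.range_eq_top.2 hσ.involutive.surjective]

theorem map_core (hσ : IsReversal σ b N) (hb : PairFreeRelations δ N b) (hv : AtLevel n v)
    (hn : n ≤ N) : σ (core b n v) = core b n v := by
  induction hv with
  | base v =>
    cases v with
    | through r => simpa [base] using hσ.map_one
    | odd => simpa [base] using hσ.map_gen 0 (by simp only [base] at hn; omega)
  | @add_two n v hv ih =>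
    have hcore : core b n v ∈ level R b n := coreSpan_le_level hv (mem_span_singleton_self _)
    rw [core_add_two b hv, hσ.map_mul, ih (by omega), hσ.map_gen _ (by omega)]
    exact hb.commute_of_mem_level hcore n.lt_succ_self (by omega)

theorem map_coreSpan (hσ : IsReversal σ b N) (hb : PairFreeRelations δ N b) (hv : AtLevel N v) :
    (coreSpan R b N v).map σ = coreSpan R b N v := by
  rw [coreSpan, map_span, Set.image_singleton, hσ.map_core hb hv le_rfl]

theorem map_lower_le (hσ : IsReversal σ b N) (hb : PairFreeRelations δ N b)
    (htop : level R b N = ⊤) : (lower R b N r).map σ ≤ lower R b N r := by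
  simp only [lower, Submodule.map_iSup]
  refine iSup_mono fun w => iSup_mono fun hw => ?_
  rw [hσ.submodule_map_mul, hσ.submodule_map_mul, hσ.map_coreSpan hb hw.1, htop,
    hσ.submodule_map_top, mul_assoc]

end IsReversal

/-- The element of the cellular basis attached to a pair of walks with the same end. -/
def cell (b : ℕ → A) (N : ℕ) (σ : A →ₗ[R] A) (i : Σ v, Path N v × Path N v) : A :=
  i.2.1.prod b * core b N i.1 * σ (i.2.2.prod b)

/-- The span of the elements of the cellular basis with fewer than `r` through strands. -/
def cellLower (b : ℕ → A) (N : ℕ) (σ : A →ₗ[R] A) (r : ℕ) : Submodule R A :=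
  span R {x | ∃ v : Vertex, v.rank < r ∧ ∃ S T : Path N v, x = cell b N σ ⟨v, S, T⟩}

theorem IsReversal.map_cell (hσ : IsReversal σ b N) (hb : PairFreeRelations δ N b)
    (S T : Path N v) : σ (cell b N σ ⟨v, S, T⟩) = cell b N σ ⟨v, T, S⟩ := by
  simp only [cell, hσ.map_mul, hσ.involutive _, hσ.map_core hb S.atLevel le_rfl, mul_assoc]

theorem cellLower_mono {s : ℕ} (h : r ≤ s) : cellLower b N σ r ≤ cellLower b N σ s := by
  refine span_mono ?_
  rintro x ⟨v, hv, hx⟩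
  exact ⟨v, hv.trans_le h, hx⟩

theorem walkSpan_mul_coreSpan_mul_map_le (hv : v.rank < r) :
    walkSpan R b N v * coreSpan R b N v * (walkSpan R b N v).map σ ≤ cellLower b N σ r := by
  rw [walkSpan, coreSpan, map_span, span_mul_span, span_mul_span]
  refine span_mono ?_
  rintro _ ⟨_, ⟨_, ⟨S, rfl⟩, _, rfl, rfl⟩, _, ⟨_, ⟨T, rfl⟩, rfl⟩, rfl⟩
  exact ⟨v, hv, S, T, rfl⟩

namespace PairFreeRelations

theorem coreSpan_mul_level_le (hb : PairFreeRelations δ N b) (hσ : IsReversal σ b N)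
    (htop : level R b N = ⊤) (hv : AtLevel N v) :
    coreSpan R b N v * level R b N ≤
      coreSpan R b N v * (walkSpan R b N v).map σ ⊔ lower R b N v.rank := by
  have h := map_mono (f := σ) (hb.level_mul_coreSpan_le hv le_rfl)
  rw [Submodule.map_sup, hσ.submodule_map_mul, hσ.submodule_map_mul, hσ.map_coreSpan hb hv, htop,
    hσ.submodule_map_top] at h
  rw [htop]
  exact h.trans (sup_le_sup_left (hσ.map_lower_le hb htop) _)

theorem lower_le_cellLower (hb : PairFreeRelations δ N b) (hσ : IsReversal σ b N)
    (htop : level R b N = ⊤) (r : ℕ) : lower R b N r ≤ cellLower b N σ r := by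
  induction r using Nat.strong_induction_on with
  | _ r ih =>
    refine iSup₂_le fun v ⟨hv, hr⟩ => ?_
    set 𝓛 := level R b N
    set 𝓔 := coreSpan R b N v
    set 𝓦 := walkSpan R b N v
    set 𝓘 := lower R b N v.rank
    calc 𝓛 * 𝓔 * 𝓛 ≤ (𝓦 * 𝓔 ⊔ 𝓘) * 𝓛 :=
          mul_le_mul_left (hb.level_mul_coreSpan_le hv le_rfl) _
      _ = 𝓦 * (𝓔 * 𝓛) ⊔ 𝓘 * 𝓛 := by rw [Submodule.sup_mul, mul_assoc]
      _ ≤ 𝓦 * (𝓔 * 𝓦.map σ ⊔ 𝓘) ⊔ 𝓘 :=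
          sup_le_sup (mul_le_mul_right (hb.coreSpan_mul_level_le hσ htop hv) _) lower_mul_level_le
      _ = 𝓦 * 𝓔 * 𝓦.map σ ⊔ (𝓦 * 𝓘 ⊔ 𝓘) := by rw [Submodule.mul_sup, mul_assoc, sup_assoc]
      _ ≤ cellLower b N σ r := by
          refine sup_le (walkSpan_mul_coreSpan_mul_map_le hr) ?_
          refine le_trans (sup_le ?_ le_rfl) ((ih _ hr).trans (cellLower_mono hr.le))
          exact (mul_le_mul_left walkSpan_le_level _).trans level_mul_lower_le

theorem exists_mul_core_sub_mem_lower (hb : PairFreeRelations δ N b) (htop : level R b N = ⊤)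
    (hv : AtLevel N v) (x : A) : ∃ c : Path N v → R,
    x * core b N v - ∑ S, c S • (S.prod b * core b N v) ∈ lower R b N v.rank := by
  have hx : x * core b N v ∈ walkSpan R b N v * coreSpan R b N v ⊔ lower R b N v.rank :=
    hb.level_mul_coreSpan_le hv le_rfl
      (mul_mem_mul (htop ▸ mem_top) (mem_span_singleton_self _))
  obtain ⟨y, hy, l, hl, h⟩ := mem_sup.1 hx
  obtain ⟨w, hw, rfl⟩ := mem_mul_span_singleton.1 hy
  obtain ⟨c, rfl⟩ := (mem_span_range_iff_exists_fun R).1 hw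
  refine ⟨c, ?_⟩
  simpa only [← h, Finset.sum_mul, smul_mul_assoc, add_sub_cancel_left] using hl

theorem span_range_cell (hb : PairFreeRelations δ N b) (hσ : IsReversal σ b N)
    (htop : level R b N = ⊤) : span R (Set.range (cell b N σ)) = ⊤ := by
  have hcell : cellLower b N σ (N + 1) ≤ span R (Set.range (cell b N σ)) := by
    refine span_mono ?_
    rintro _ ⟨v, -, S, T, rfl⟩
    exact ⟨_, rfl⟩
  have hlower : level R b N * coreSpan R b N (through N) * level R b N ≤ lower R b N (N + 1) :=
    le_iSup₂_of_le (through N) ⟨.through N, N.lt_succ_self⟩ le_rfl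
  rw [coreSpan_through, mul_one, level_mul_level, htop] at hlower
  exact top_le_iff.1 (hlower.trans ((hb.lower_le_cellLower hσ htop _).trans hcell))

theorem exists_mul_cell_sub_mem_cellLower (hb : PairFreeRelations δ N b) (hσ : IsReversal σ b N)
    (htop : level R b N = ⊤) (a : A) (v : Vertex) : ∃ c : Path N v → Path N v → R, ∀ S T,
    a * cell b N σ ⟨v, S, T⟩ - ∑ S', c S' S • cell b N σ ⟨v, S', T⟩ ∈ cellLower b N σ v.rank := by
  choose c hc using fun S : Path N v =>
    hb.exists_mul_core_sub_mem_lower htop S.atLevel (a * S.prod b)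
  refine ⟨fun S' S => c S S', fun S T => hb.lower_le_cellLower hσ htop _ ?_⟩
  have h := lower_mul_level_le (mul_mem_mul (hc S) (htop ▸ mem_top : σ (T.prod b) ∈ level R b N))
  simpa only [cell, sub_mul, Finset.sum_mul, smul_mul_assoc, mul_assoc] using h

theorem isCellular {R : Type*} {A : Type} [CommRing R] [Nontrivial R] [Ring A] [Algebra R A] {δ : R}
    {b : ℕ → A} {σ : A →ₗ[R] A} (hb : PairFreeRelations δ N b) (hσ : IsReversal σ b N)
    (htop : level R b N = ⊤) (hcell : LinearIndependent R (cell b N σ)) : IsCellular R A :=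
  ⟨{  Λ := Vertex
      M := Path N
      C := cell b N σ
      C_injective := hcell.injective
      C_linearIndependent := hcell
      C_span := hb.span_range_cell hσ htop
      star := σ
      star_star := hσ.involutive
      star_mul := hσ.map_mul
      star_C := fun _ => hσ.map_cell hb
      mul_C := fun a v => by
        simpa only [lt_iff_rank_lt, cellLower] using
            hb.exists_mul_cell_sub_mem_cellLower hσ htop a v }⟩

end PairFreeRelations

end Cell

/-! ### The representation on functions of colourings -/

/-- Colours: `d` pairs of colours, exchanged by an involution without fixed points. -/
abbrev Colour (d : ℕ) : Type :=
  Fin d × Bool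

/-- The involution of the colours. -/
def Colour.bar {d : ℕ} (c : Colour d) : Colour d :=
  (c.1, !c.2)

@[simp]
theorem Colour.bar_bar {d : ℕ} (c : Colour d) : c.bar.bar = c := by
  simp [bar]

theorem Colour.bar_ne {d : ℕ} (c : Colour d) : c.bar ≠ c := by
  simp [bar, Prod.ext_iff]

/-- Colourings of infinitely many strands, so that creating and annihilating strands does not change
the space. -/
abbrev Colouring (d : ℕ) : Type :=
  ℕ → Colour d

namespace Colouring

variable {d p q : ℕ} {c : Colour d} {x : Colouring d}

/-- Remove the strands `p` and `p + 1`. -/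
def removePair (p : ℕ) (x : Colouring d) : Colouring d :=
  fun i => if i < p then x i else x (i + 2)

/-- Insert two strands of the colour `c` at `p` and `p + 1`. -/
def insertPair (p : ℕ) (c : Colour d) (x : Colouring d) : Colouring d :=
  fun i => if i < p then x i else if i < p + 2 then c else x (i - 2)

/-- A decoration on the leftmost strand changes its colour by the involution. -/
def flipFirst (x : Colouring d) : Colouring d :=
  fun i => if i = 0 then (x 0).bar else x i

@[simp]
theorem flipFirst_flipFirst (x : Colouring d) : x.flipFirst.flipFirst = x := by
  funext i
  rcases i with _ | i <;> simp [flipFirst]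

theorem flipFirst_removePair (p : ℕ) (x : Colouring d) :
    x.flipFirst.removePair (p + 1) = (x.removePair (p + 1)).flipFirst := by
  funext i
  simp only [removePair, flipFirst]
  grind

theorem insertPair_flipFirst (p : ℕ) (c : Colour d) (x : Colouring d) :
    insertPair (p + 1) c x.flipFirst = (insertPair (p + 1) c x).flipFirst := by
  funext i
  simp only [insertPair, flipFirst]
  grind

theorem insertPair_of_lt {i : ℕ} (h : i < p) : insertPair p c x i = x i := by
  simp [insertPair, h]

@[simp]
theorem insertPair_self : insertPair p c x p = c := by
  simp [insertPair]

@[simp]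
theorem insertPair_succ : insertPair p c x (p + 1) = c := by
  simp [insertPair]

theorem insertPair_add_two {i : ℕ} (h : p ≤ i) : insertPair p c x (i + 2) = x i := by
  simp only [insertPair]
  grind

theorem removePair_of_lt {i : ℕ} (h : i < p) : x.removePair p i = x i := by
  simp [removePair, h]

theorem removePair_of_le {i : ℕ} (h : p ≤ i) : x.removePair p i = x (i + 2) := by
  simp [removePair, h]

@[simp]
theorem removePair_insertPair (p : ℕ) (c : Colour d) (x : Colouring d) :
    (insertPair p c x).removePair p = x := by
  funext i
  simp only [removePair, insertPair]
  grind

theorem insertPair_removePair (h : x p = c) (h' : x (p + 1) = c) :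
    insertPair p c (x.removePair p) = x := by
  funext i
  simp only [removePair, insertPair]
  grind

theorem removePair_succ_insertPair (h : x p = c) :
    (insertPair p c x).removePair (p + 1) = x := by
  funext i
  simp only [removePair, insertPair]
  grind

theorem removePair_insertPair_succ (h : x p = c) :
    (insertPair (p + 1) c x).removePair p = x := by
  funext i
  simp only [removePair, insertPair]
  grind

theorem removePair_removePair (h : p ≤ q) (x : Colouring d) :
    (x.removePair (q + 2)).removePair p = (x.removePair p).removePair q := by
  funext i
  simp only [removePair]
  grind

theorem insertPair_insertPair (h : p ≤ q) (c c' : Colour d) (x : Colouring d) :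
    insertPair (q + 2) c (insertPair p c' x) = insertPair p c' (insertPair q c x) := by
  funext i
  simp only [insertPair]
  grind

theorem removePair_insertPair_add_two (h : p ≤ q) (c : Colour d) (x : Colouring d) :
    (insertPair (q + 2) c x).removePair p = insertPair q c (x.removePair p) := by
  funext i
  simp only [insertPair, removePair]
  grind

theorem removePair_add_two_insertPair (h : p ≤ q) (c : Colour d) (x : Colouring d) :
    (insertPair p c x).removePair (q + 2) = insertPair p c (x.removePair q) := by
  funext i
  simp only [insertPair, removePair]
  grind

end Colouring

open Colouring

/-- The operators on the space of functions of colourings. -/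
abbrev Operator (R M : Type*) [CommRing R] [AddCommGroup M] [Module R M] (d : ℕ) : Type _ :=
  Module.End R (Colouring d → M)

section Operators

variable {R M : Type*} [CommRing R] [AddCommGroup M] [Module R M] {d p q : ℕ}

/-- Creation of a pair of adjacent strands of the same colour. -/
def cup (p : ℕ) : Operator R M d :=
  LinearMap.pi fun x => if x p = x (p + 1) then LinearMap.proj (x.removePair p) else 0

/-- Annihilation of a pair of adjacent strands: the sum over their common colour. -/
def cap (p : ℕ) : Operator R M d :=
  ∑ c, LinearMap.funLeft R M (insertPair p c)

/-- The decoration of the leftmost strand. -/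
def dot : Operator R M d :=
  LinearMap.funLeft R M flipFirst

theorem cup_apply (p : ℕ) (f : Colouring d → M) (x : Colouring d) :
    cup (R := R) p f x = if x p = x (p + 1) then f (x.removePair p) else 0 := by
  simp only [cup, LinearMap.pi_apply]
  split_ifs <;> rfl

theorem cap_apply (p : ℕ) (f : Colouring d → M) (x : Colouring d) :
    cap (R := R) p f x = ∑ c, f (insertPair p c x) := by
  simp [cap, LinearMap.funLeft_apply]

theorem dot_apply (f : Colouring d → M) (x : Colouring d) :
    dot (R := R) f x = f x.flipFirst :=
  rfl

theorem dot_involutive : Function.Involutive (dot : Operator R M d) := fun f => by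
  funext x
  simp [dot_apply]

theorem cap_mul_cup (p : ℕ) {δ : R} (hδ : ∀ m : M, δ • m = (2 * d) • m) :
    (cap p * cup p : Operator R M d) = δ • 1 := by
  ext1 f
  funext x
  simp [Module.End.mul_apply, cap_apply, cup_apply, hδ, mul_comm]

theorem cap_mul_cup_succ (p : ℕ) : (cap p * cup (p + 1) : Operator R M d) = 1 := by
  ext1 f
  funext x
  have hterm (c : Colour d) :
      cup (R := R) (p + 1) f (insertPair p c x) = if x p = c then f x else 0 := by
    rw [cup_apply, insertPair_succ, insertPair_add_two le_rfl]
    by_cases hc : x p = c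
    · rw [if_pos hc, if_pos hc.symm, removePair_succ_insertPair hc]
    · rw [if_neg hc, if_neg (Ne.symm hc)]
  simp [Module.End.mul_apply, cap_apply, hterm]

theorem cap_succ_mul_cup (p : ℕ) : (cap (p + 1) * cup p : Operator R M d) = 1 := by
  ext1 f
  funext x
  have hterm (c : Colour d) :
      cup (R := R) p f (insertPair (p + 1) c x) = if x p = c then f x else 0 := by
    rw [cup_apply, insertPair_self, insertPair_of_lt p.lt_succ_self]
    by_cases hc : x p = c
    · rw [if_pos hc, if_pos hc, removePair_insertPair_succ hc]
    · rw [if_neg hc, if_neg hc]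
  simp [Module.End.mul_apply, cap_apply, hterm]

theorem cup_mul_cup (h : p ≤ q) :
    (cup (q + 2) * cup p : Operator R M d) = cup p * cup q := by
  ext1 f
  funext x
  simp only [Module.End.mul_apply, cup_apply, removePair_removePair h,
    removePair_of_lt (show p < q + 2 by omega), removePair_of_lt (show p + 1 < q + 2 by omega),
    removePair_of_le h, removePair_of_le (show p ≤ q + 1 by omega)]
  split_ifs <;> rfl

theorem cap_mul_cap (h : p ≤ q) :
    (cap p * cap (q + 2) : Operator R M d) = cap q * cap p := by
  ext1 f
  funext x
  simp only [Module.End.mul_apply, cap_apply, insertPair_insertPair h]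
  exact Finset.sum_comm

theorem cap_add_two_mul_cup (h : p ≤ q) :
    (cap (q + 2) * cup p : Operator R M d) = cup p * cap q := by
  ext1 f
  funext x
  simp only [Module.End.mul_apply, cap_apply, cup_apply, removePair_insertPair_add_two h,
    insertPair_of_lt (show p < q + 2 by omega), insertPair_of_lt (show p + 1 < q + 2 by omega)]
  split_ifs <;> simp

theorem cap_mul_cup_add_two (h : p ≤ q) :
    (cap p * cup (q + 2) : Operator R M d) = cup q * cap p := by
  ext1 f
  funext x
  simp only [Module.End.mul_apply, cap_apply, cup_apply, removePair_add_two_insertPair h,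
    insertPair_add_two h, insertPair_add_two (show p ≤ q + 1 by omega), Nat.add_right_comm q 2 1]
  split_ifs <;> simp

theorem commute_dot_cup_succ (p : ℕ) : Commute (dot : Operator R M d) (cup (p + 1)) := by
  ext1 f
  funext x
  simp only [Module.End.mul_apply, dot_apply, cup_apply, flipFirst_removePair]
  simp [flipFirst]

theorem commute_dot_cap_succ (p : ℕ) : Commute (dot : Operator R M d) (cap (p + 1)) := by
  ext1 f
  funext x
  simp only [Module.End.mul_apply, dot_apply, cap_apply, insertPair_flipFirst]

theorem cap_mul_dot_mul_cup : (cap 0 * dot * cup 0 : Operator R M d) = 0 := by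
  ext1 f
  funext x
  simp [Module.End.mul_apply, dot_apply, cap_apply, cup_apply, flipFirst, insertPair,
    Colour.bar_ne]

/-- Conjugation by the decoration of the leftmost strand. -/
def conjDot : Operator R M d ≃ₐ[R] Operator R M d :=
  (LinearEquiv.ofInvolutive dot dot_involutive).conjAlgEquiv R

theorem conjDot_apply (x : Operator R M d) : conjDot x = dot * x * dot :=
  rfl

theorem conjDot_eq_self {x : Operator R M d} (hx : Commute dot x) : conjDot x = x := by
  ext1 f
  rw [conjDot_apply, hx.eq, Module.End.mul_apply, Module.End.mul_apply, dot_involutive]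

/-- The operators representing the generators. -/
def gen : ℕ → Operator R M d
  | 0 => conjDot (cup 0 * cap 0)
  | p + 1 => cup p * cap p

theorem gen_zero : (gen 0 : Operator R M d) = conjDot (gen 1) :=
  rfl

theorem gen_succ (p : ℕ) : (gen (p + 1) : Operator R M d) = cup p * cap p :=
  rfl

theorem commute_dot_gen_add_two (p : ℕ) : Commute (dot : Operator R M d) (gen (p + 2)) :=
  (commute_dot_cup_succ p).mul_right (commute_dot_cap_succ p)

theorem gen_add_three_mul_cup (h : p ≤ q) :
    (gen (q + 3) * cup p : Operator R M d) = cup p * gen (q + 1) := by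
  rw [gen_succ, gen_succ, mul_assoc, cap_add_two_mul_cup h, ← mul_assoc, cup_mul_cup h, mul_assoc]

theorem cap_mul_gen_add_three (h : p ≤ q) :
    (cap p * gen (q + 3) : Operator R M d) = gen (q + 1) * cap p := by
  rw [gen_succ, gen_succ, ← mul_assoc, cap_mul_cup_add_two h, mul_assoc, cap_mul_cap h, mul_assoc]

theorem commute_gen_succ (h : p ≤ q) :
    Commute (gen (p + 1) : Operator R M d) (gen (q + 3)) := by
  rw [commute_iff_eq, gen_succ p, mul_assoc, cap_mul_gen_add_three h, ← mul_assoc,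
    ← gen_add_three_mul_cup h, mul_assoc]

theorem commute_gen_zero (q : ℕ) : Commute (gen 0 : Operator R M d) (gen (q + 3)) := by
  rw [gen_zero, ← conjDot_eq_self (commute_dot_gen_add_two (q + 1))]
  exact (commute_gen_succ q.zero_le).map conjDot

theorem gen_succ_mul_self {δ : R} (hδ : ∀ m : M, δ • m = (2 * d) • m) (p : ℕ) :
    (gen (p + 1) * gen (p + 1) : Operator R M d) = δ • gen (p + 1) :=
  calc cup p * cap p * (cup p * cap p) = cup p * (cap p * cup p) * cap p := by
        simp only [mul_assoc]
    _ = δ • (cup p * cap p) := by rw [cap_mul_cup p hδ, mul_smul_one, smul_mul_assoc]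

theorem gen_succ_braid (p : ℕ) :
    (gen (p + 1) * gen (p + 2) * gen (p + 1) : Operator R M d) = gen (p + 1) :=
  calc cup p * cap p * (cup (p + 1) * cap (p + 1)) * (cup p * cap p)
      = cup p * (cap p * cup (p + 1)) * (cap (p + 1) * cup p) * cap p := by simp only [mul_assoc]
    _ = cup p * cap p := by rw [cap_mul_cup_succ, cap_succ_mul_cup, mul_one, mul_one]

theorem gen_succ_braid' (p : ℕ) :
    (gen (p + 2) * gen (p + 1) * gen (p + 2) : Operator R M d) = gen (p + 2) :=
  calc cup (p + 1) * cap (p + 1) * (cup p * cap p) * (cup (p + 1) * cap (p + 1))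
      = cup (p + 1) * (cap (p + 1) * cup p) * (cap p * cup (p + 1)) * cap (p + 1) := by
        simp only [mul_assoc]
    _ = cup (p + 1) * cap (p + 1) := by rw [cap_mul_cup_succ, cap_succ_mul_cup, mul_one, mul_one]

theorem gen_one_mul_gen_zero : (gen 1 * gen 0 : Operator R M d) = 0 :=
  calc cup 0 * cap 0 * (dot * (cup 0 * cap 0) * dot)
      = cup 0 * (cap 0 * dot * cup 0) * cap 0 * dot := by simp only [mul_assoc]
    _ = 0 := by rw [cap_mul_dot_mul_cup, mul_zero, zero_mul, zero_mul]

theorem gen_zero_mul_gen_one : (gen 0 * gen 1 : Operator R M d) = 0 :=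
  calc dot * (cup 0 * cap 0) * dot * (cup 0 * cap 0)
      = dot * cup 0 * (cap 0 * dot * cup 0) * cap 0 := by simp only [mul_assoc]
    _ = 0 := by rw [cap_mul_dot_mul_cup, mul_zero, zero_mul]

theorem pairFreeRelations_gen {δ : R} (hδ : ∀ m : M, δ • m = (2 * d) • m) (N : ℕ) :
    PairFreeRelations δ N (gen : ℕ → Operator R M d) where
  mul_self i _ := by
    cases i with
    | zero => rw [gen_zero, ← map_mul, gen_succ_mul_self hδ, map_smul]
    | succ i => exact gen_succ_mul_self hδ i
  commute i j hij _ hj := by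
    unfold Joined at hj
    obtain ⟨rfl, rfl⟩ | ⟨k, rfl⟩ : (i = 0 ∧ j = 1) ∨ ∃ k, j = k + 3 := by
      by_cases hj3 : 3 ≤ j
      · exact .inr ⟨j - 3, by omega⟩
      · omega
    · exact gen_zero_mul_gen_one.trans gen_one_mul_gen_zero.symm
    · cases i with
      | zero => exact commute_gen_zero k
      | succ i => exact commute_gen_succ (by omega)
  braid i j hij _ := by
    obtain ⟨hi, rfl⟩ | ⟨rfl, rfl⟩ := hij
    · obtain ⟨p, rfl⟩ := Nat.exists_eq_add_of_le' hi
      exact gen_succ_braid p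
    · conv_lhs => rw [gen_zero, ← conjDot_eq_self (commute_dot_gen_add_two 0)]
      rw [← map_mul, ← map_mul, gen_succ_braid, gen_zero]
  braid' i j hij _ := by
    obtain ⟨hi, rfl⟩ | ⟨rfl, rfl⟩ := hij
    · obtain ⟨p, rfl⟩ := Nat.exists_eq_add_of_le' hi
      exact gen_succ_braid' p
    · rw [gen_zero, ← conjDot_eq_self (commute_dot_gen_add_two 0), ← map_mul, ← map_mul,
        gen_succ_braid']
  pair _ := gen_one_mul_gen_zero

end Operators

/-! ### Half-diagrams -/

/-- The number of arcs in a half-diagram at level `n` with end `v`. -/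
def arcs (n : ℕ) (v : Vertex) : ℕ :=
  (n - v.rank) / 2

theorem arcs_succ_up (n : ℕ) (v : Vertex) : arcs (n + 1) v.up = arcs n v := by
  simp [arcs]

theorem arcs_succ {n : ℕ} {v : Vertex} (h : AtLevel n v.up) :
    arcs (n + 1) v = arcs n v.up + 1 := by
  have := h.rank_le
  simp only [arcs, rank_up] at *
  omega

theorem arcs_add_two {n : ℕ} {v : Vertex} (h : AtLevel n v) : arcs (n + 2) v = arcs n v + 1 := by
  have := h.rank_le
  simp only [arcs]
  omega

theorem rank_add_two_mul_arcs {n : ℕ} {v : Vertex} (h : AtLevel n v) :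
    v.rank + 2 * arcs n v = n := by
  have := h.rank_le
  have := h.mod_two_eq
  simp only [arcs]
  omega

/-- The effect on colourings of the decoration that belongs to a vertex. -/
def Colouring.twist {d : ℕ} : Vertex → Colouring d → Colouring d
  | .through _, x => x
  | .odd, x => x.flipFirst

section HalfDiagrams

variable {R M : Type*} [CommRing R] [AddCommGroup M] [Module R M] {d n N : ℕ} {v : Vertex}

/-- The operator of the decoration that belongs to a vertex. -/
def twist (v : Vertex) : Operator R M d :=
  LinearMap.funLeft R M (Colouring.twist v)

theorem twist_through (r : ℕ) : (twist (.through r) : Operator R M d) = 1 :=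
  rfl

theorem twist_odd : (twist odd : Operator R M d) = dot :=
  rfl

theorem twist_up (v : Vertex) : (twist v.up : Operator R M d) = 1 := by
  cases v <;> rfl

theorem commute_twist {x : Operator R M d} (h : Commute dot x) (v : Vertex) :
    Commute (twist v) x := by
  cases v with
  | through r => exact Commute.one_left x
  | odd => exact h

variable (R M d n v) in
/-- Creation of the half-diagram whose through strands come first, followed by adjacent cups. -/
def stdCup : Operator R M d :=
  twist v * cup v.rank ^ arcs n v

variable (R M d n v) in
/-- Annihilation of the half-diagram whose through strands come first, followed by adjacent caps. -/
def stdCap : Operator R M d :=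
  cap v.rank ^ arcs n v * twist v

theorem cap_pow_mul_cup_succ_pow (p k : ℕ) :
    (cap p ^ k * cup (p + 1) ^ k : Operator R M d) = 1 := by
  induction k with
  | zero => simp
  | succ k ih =>
    rw [pow_succ, pow_succ', mul_assoc, ← mul_assoc (cap p), cap_mul_cup_succ, one_mul, ih]

theorem cap_succ_pow_mul_cup_pow (p k : ℕ) :
    (cap (p + 1) ^ k * cup p ^ k : Operator R M d) = 1 := by
  induction k with
  | zero => simp
  | succ k ih =>
    rw [pow_succ, pow_succ', mul_assoc, ← mul_assoc (cap (p + 1)), cap_succ_mul_cup, one_mul, ih]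

theorem gen_mul_cup_pow (p k : ℕ) :
    (gen (p + 2 * k + 1) * cup p ^ k : Operator R M d) = cup p ^ k * gen (p + 1) := by
  induction k with
  | zero => simp
  | succ k ih =>
    rw [pow_succ', ← mul_assoc, show p + 2 * (k + 1) + 1 = p + 2 * k + 3 by ring,
      gen_add_three_mul_cup (by omega), mul_assoc, ih, mul_assoc]

theorem stdCap_mul_stdCup_succ_up :
    stdCap R M d n v * stdCup R M d (n + 1) v.up = twist v :=
  calc stdCap R M d n v * stdCup R M d (n + 1) v.up
      = cap v.rank ^ arcs n v * (twist v * cup (v.rank + 1) ^ arcs n v) := by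
        rw [stdCap, stdCup, twist_up, one_mul, rank_up, arcs_succ_up, mul_assoc]
    _ = twist v := by
        rw [((commute_twist (commute_dot_cup_succ _) v).pow_right _).eq, ← mul_assoc,
          cap_pow_mul_cup_succ_pow, one_mul]

theorem stdCap_up_mul_stdCup_succ (h : AtLevel n v.up) :
    stdCap R M d n v.up * stdCup R M d (n + 1) v = twist v * cup v.rank :=
  calc stdCap R M d n v.up * stdCup R M d (n + 1) v
      = cap (v.rank + 1) ^ arcs n v.up * twist v * cup v.rank ^ arcs n v.up * cup v.rank := by
        rw [stdCap, stdCup, twist_up, mul_one, rank_up, arcs_succ h, pow_succ]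
        simp only [mul_assoc]
    _ = twist v * cup v.rank := by
        rw [← ((commute_twist (commute_dot_cap_succ _) v).pow_right _).eq, mul_assoc (twist v),
          cap_succ_pow_mul_cup_pow, mul_one]

theorem stdCap_succ_up_mul_stdCup :
    stdCap R M d (n + 1) v.up * stdCup R M d n v = twist v :=
  calc stdCap R M d (n + 1) v.up * stdCup R M d n v
      = cap (v.rank + 1) ^ arcs n v * twist v * cup v.rank ^ arcs n v := by
        rw [stdCap, stdCup, twist_up, mul_one, rank_up, arcs_succ_up, mul_assoc]
    _ = twist v := by
        rw [← ((commute_twist (commute_dot_cap_succ _) v).pow_right _).eq, mul_assoc,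
          cap_succ_pow_mul_cup_pow, mul_one]

theorem stdCap_succ_mul_stdCup_up (h : AtLevel n v.up) :
    stdCap R M d (n + 1) v * stdCup R M d n v.up = cap v.rank * twist v :=
  calc stdCap R M d (n + 1) v * stdCup R M d n v.up
      = cap v.rank * (cap v.rank ^ arcs n v.up * (twist v * cup (v.rank + 1) ^ arcs n v.up)) := by
        rw [stdCap, stdCup, twist_up, one_mul, rank_up, arcs_succ h, pow_succ']
        simp only [mul_assoc]
    _ = cap v.rank * twist v := by
        rw [((commute_twist (commute_dot_cup_succ _) v).pow_right _).eq,
          ← mul_assoc (cap v.rank ^ _), cap_pow_mul_cup_succ_pow, one_mul]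

theorem commute_twist_gen_succ (h : AtLevel n v) :
    Commute (twist v : Operator R M d) (gen (n + 1)) := by
  cases v with
  | through r => exact Commute.one_left _
  | odd =>
    obtain ⟨m, rfl⟩ := Nat.exists_eq_add_of_le' h.base_le
    exact commute_dot_gen_add_two (m + 1)

theorem gen_succ_mul_stdCup_mul_stdCap (h : AtLevel n v) :
    gen (n + 1) * (stdCup R M d n v * stdCap R M d n v) =
      stdCup R M d (n + 2) v * stdCap R M d (n + 2) v := by
  have hgen : (gen (n + 1) * cup v.rank ^ arcs n v : Operator R M d) =
      cup v.rank ^ arcs n v * (cup v.rank * cap v.rank) := by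
    have hcup := gen_mul_cup_pow (R := R) (M := M) (d := d) v.rank (arcs n v)
    rwa [rank_add_two_mul_arcs h] at hcup
  calc gen (n + 1) * (twist v * cup v.rank ^ arcs n v * stdCap R M d n v)
      = twist v * (gen (n + 1) * cup v.rank ^ arcs n v) * stdCap R M d n v := by
        rw [← mul_assoc, ← mul_assoc, ← (commute_twist_gen_succ h).eq]
        simp only [mul_assoc]
    _ = stdCup R M d (n + 2) v * stdCap R M d (n + 2) v := by
        rw [hgen, stdCup, stdCap, stdCap, arcs_add_two h, pow_succ, pow_succ']
        simp only [mul_assoc]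

end HalfDiagrams

namespace Colouring

variable {d : ℕ}

@[simp]
theorem twist_twist (v : Vertex) (x : Colouring d) : (x.twist v).twist v = x := by
  cases v <;> simp [twist]

@[simp]
theorem twist_apply_fst (v : Vertex) (x : Colouring d) (i : ℕ) : (x.twist v i).1 = (x i).1 := by
  cases v <;> cases i <;> simp [twist, flipFirst, Colour.bar]

@[simp]
theorem twist_apply_succ (v : Vertex) (x : Colouring d) (i : ℕ) :
    x.twist v (i + 1) = x (i + 1) := by
  cases v <;> simp [twist, flipFirst]

end Colouring

namespace Path

variable {d n : ℕ} {v : Vertex}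

/-- Match a colouring against the half-diagram of a walk: the result has the colours of the through
strands, followed by the unused colours. -/
def read : ∀ {n : ℕ} {v : Vertex}, Path n v → Colouring d → Option (Colouring d)
  | _, _, .nil, x => some x
  | _, _, .up (v := v) p, x => (p.read x).map (Colouring.twist v)
  | _, _, .down (v := v) p, x => (p.read x).bind fun w =>
      if w.twist v v.rank = w (v.rank + 1) then some ((w.twist v).removePair v.rank) else none

/-- The colouring that matches the half-diagram of a walk in which the arc closed at the step `m`
has the colour `c m` and the through strands and the unused strands are coloured by `z`. -/
def lift (c : ℕ → Fin d) : ∀ {n : ℕ} {v : Vertex}, Path n v → Colouring d → Colouring d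
  | _, _, .nil, z => z
  | _, _, .up (v := v) p, z => p.lift c (z.twist v)
  | _, _, .down (n := n) (v := v) p, z =>
      p.lift c ((insertPair v.rank (c n, false) z).twist v)

theorem read_up_eq_some {p : Path n v} {x w : Colouring d} :
    p.up.read x = some w ↔ ∃ y, p.read x = some y ∧ y.twist v = w :=
  Option.map_eq_some_iff

theorem read_down_eq_some {p : Path n v.up} {x w : Colouring d} :
    p.down.read x = some w ↔ ∃ y, p.read x = some y ∧ y.twist v v.rank = y (v.rank + 1) ∧
      (y.twist v).removePair v.rank = w := by
  simp [read, Option.bind_eq_some_iff]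

@[simp]
theorem read_lift (c : ℕ → Fin d) (p : Path n v) (z : Colouring d) :
    p.read (p.lift c z) = some z := by
  induction p generalizing z with
  | nil => rfl
  | up p ih => exact read_up_eq_some.2 ⟨_, ih _, twist_twist _ _⟩
  | @down n v p ih =>
    refine read_down_eq_some.2 ⟨_, ih _, ?_, ?_⟩
    · rw [twist_twist, twist_apply_succ, insertPair_self, insertPair_succ]
    · rw [twist_twist, removePair_insertPair]

theorem apply_rank_add_of_read {p : Path n v} {x w : Colouring d} (h : p.read x = some w) (i : ℕ) :
    w (v.rank + i) = x (n + i) := by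
  induction p generalizing w i with
  | nil =>
    obtain rfl := Option.some.inj h
    simp [rank]
  | @up n v p ih =>
    obtain ⟨y, hy, rfl⟩ := read_up_eq_some.1 h
    rw [rank_up, Nat.add_right_comm, twist_apply_succ, Nat.add_right_comm n]
    exact ih hy (i + 1)
  | @down n v p ih =>
    obtain ⟨y, hy, -, rfl⟩ := read_down_eq_some.1 h
    rw [removePair_of_le (Nat.le_add_right _ _), twist_apply_succ, Nat.add_right_comm]
    rw [Nat.add_right_comm n, Nat.add_right_comm v.rank, ← rank_up, Nat.add_assoc, Nat.add_assoc]
    exact ih hy (i + 1)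

theorem exists_fst_eq_of_read {p : Path n v} {x w : Colouring d} (h : p.read x = some w) {j : ℕ}
    (hj : j < v.rank) : ∃ i < n, (w j).1 = (x i).1 := by
  induction p generalizing w j with
  | nil => simp [rank] at hj
  | @up n v p ih =>
    obtain ⟨y, hy, rfl⟩ := read_up_eq_some.1 h
    rw [rank_up] at hj
    simp only [twist_apply_fst]
    obtain hj | rfl : j < v.rank ∨ j = v.rank := by omega
    · obtain ⟨i, hi, hij⟩ := ih hy hj
      exact ⟨i, by omega, hij⟩
    · exact ⟨n, n.lt_succ_self, congrArg Prod.fst (apply_rank_add_of_read hy 0)⟩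
  | @down n v p ih =>
    obtain ⟨y, hy, -, rfl⟩ := read_down_eq_some.1 h
    obtain ⟨i, hi, hij⟩ := ih hy (j := j) (by rw [rank_up]; omega)
    exact ⟨i, by omega, by rwa [removePair_of_lt hj, twist_apply_fst]⟩

theorem exists_fst_eq_of_read_down {p : Path n v.up} {x w : Colouring d}
    (h : p.down.read x = some w) : ∃ i < n, (x i).1 = (x n).1 := by
  obtain ⟨y, hy, hpair, -⟩ := read_down_eq_some.1 h
  obtain ⟨i, hi, hij⟩ := exists_fst_eq_of_read hy (j := v.rank) (by simp)
  have hn : y (v.rank + 1) = x n := by simpa using apply_rank_add_of_read hy 0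
  exact ⟨i, hi, by rw [← hij, ← hn, ← hpair, twist_apply_fst]⟩

theorem lift_apply_self (c : ℕ → Fin d) (p : Path n v) (z : Colouring d) :
    p.lift c z n = z v.rank :=
  (apply_rank_add_of_read (p.read_lift c z) 0).symm

theorem exists_lift_apply_fst_eq (c : ℕ → Fin d) (p : Path n v) (z : Colouring d) {i : ℕ}
    (hi : i < n) :
    (∃ j < v.rank, (p.lift c z i).1 = (z j).1) ∨ ∃ m < n, (p.lift c z i).1 = c m := by
  induction p generalizing z with
  | nil => omega
  | @up n v p ih =>
    obtain hi | rfl : i < n ∨ i = n := by omega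
    · obtain ⟨j, hj, h⟩ | ⟨m, hm, h⟩ := ih (z.twist v) hi
      · exact .inl ⟨j, by rw [rank_up]; omega, by simpa [lift] using h⟩
      · exact .inr ⟨m, by omega, h⟩
    · exact .inl ⟨v.rank, by simp, by rw [lift, lift_apply_self, twist_apply_fst]⟩
  | @down n v p ih =>
    obtain hi | rfl : i < n ∨ i = n := by omega
    · obtain ⟨j, hj, h⟩ | ⟨m, hm, h⟩ := ih ((insertPair v.rank (c n, false) z).twist v) hi
      · rw [twist_apply_fst] at h
        obtain hj | rfl : j < v.rank ∨ j = v.rank := by rw [rank_up] at hj; omega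
        · exact .inl ⟨j, hj, by rwa [insertPair_of_lt hj] at h⟩
        · exact .inr ⟨n, n.lt_succ_self, by rwa [insertPair_self] at h⟩
      · exact .inr ⟨m, by omega, h⟩
    · exact .inr ⟨i, i.lt_succ_self, by
        rw [lift, lift_apply_self, rank_up, twist_apply_fst, insertPair_succ]⟩

end Path

/-- The first `r` colours of `z` belong to pairwise different pairs, which also differ from the
first `n` terms of `c`. -/
structure Fresh {d : ℕ} (c : ℕ → Fin d) (n r : ℕ) (z : Colouring d) : Prop where
  fst_ne_color : ∀ i < r, ∀ m < n, (z i).1 ≠ c m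
  fst_ne_fst : ∀ i j, i < j → j < r → (z i).1 ≠ (z j).1

namespace Fresh

variable {d n r : ℕ} {c : ℕ → Fin d} {z : Colouring d}

theorem of_succ (hz : Fresh c (n + 1) (r + 1) z) : Fresh c n r z where
  fst_ne_color i hi m hm := hz.fst_ne_color i (by omega) m (by omega)
  fst_ne_fst i j hij hj := hz.fst_ne_fst i j hij (by omega)

theorem twist (hz : Fresh c n r z) (v : Vertex) : Fresh c n r (z.twist v) where
  fst_ne_color i hi m hm := by simpa using hz.fst_ne_color i hi m hm
  fst_ne_fst i j hij hj := by simpa using hz.fst_ne_fst i j hij hj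

theorem insertPair {N : ℕ} (hc : Set.InjOn c (Set.Iio N)) (hn : n < N) (hz : Fresh c (n + 1) r z)
    (a : Bool) : Fresh c n (r + 1) (insertPair r (c n, a) z) where
  fst_ne_color i hi m hm := by
    obtain hi | rfl : i < r ∨ i = r := by omega
    · rw [insertPair_of_lt hi]
      exact hz.fst_ne_color i hi m (by omega)
    · rw [insertPair_self]
      exact fun h => hm.ne' (hc hn (hm.trans hn) h)
  fst_ne_fst i j hij hj := by
    obtain hj | rfl : j < r ∨ j = r := by omega
    · rw [insertPair_of_lt hj, insertPair_of_lt (hij.trans hj)]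
      exact hz.fst_ne_fst i j hij hj
    · rw [insertPair_self, insertPair_of_lt hij]
      exact hz.fst_ne_color i hij n n.lt_succ_self

end Fresh

namespace Path

variable {d n N : ℕ} {v v' : Vertex} {c : ℕ → Fin d} {z : Colouring d}

theorem not_read_down_lift_up {p : Path n v} {q : Path n v'.up} {w : Colouring d}
    (hz : Fresh c (n + 1) (v.rank + 1) z) : q.down.read (p.up.lift c z) ≠ some w := by
  intro h
  obtain ⟨i, hi, hin⟩ := exists_fst_eq_of_read_down h
  rw [lift, lift_apply_self, twist_apply_fst] at hin
  obtain ⟨j, hj, hij⟩ | ⟨m, hm, him⟩ := p.exists_lift_apply_fst_eq c (z.twist v) hi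
  · rw [twist_apply_fst] at hij
    exact hz.fst_ne_fst j v.rank hj (by omega) (hij.symm.trans hin)
  · exact hz.fst_ne_color v.rank (by omega) m (by omega) (hin.symm.trans him)

/-- The two vertices below `through 1` are told apart by the colours of an arc, which the decoration
makes different. -/
theorem eq_of_twist_insertPair {a : Colour d} (h : v'.up = v.up)
    (hpair : ((insertPair v.rank a z).twist v).twist v' v'.rank =
      (insertPair v.rank a z).twist v (v'.rank + 1)) : v' = v := by
  rw [twist_apply_succ] at hpair
  cases v <;> cases v' <;>
    simp_all [Vertex.up, rank, Colouring.twist, flipFirst, insertPair, Colour.bar_ne]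

theorem eq_of_read_lift (hc : Set.InjOn c (Set.Iio N)) (p : Path n v) (hn : n ≤ N)
    (hz : Fresh c n v.rank z) {q : Path n v'} {w : Colouring d}
    (hq : q.read (p.lift c z) = some w) (hle : v'.rank ≤ v.rank) :
    (⟨v', q⟩ : Σ v, Path n v) = ⟨v, p⟩ := by
  induction p generalizing v' z w with
  | nil => cases q; rfl
  | @up n v p ih =>
    rw [rank_up] at hz hle
    cases q with
    | up q =>
      obtain ⟨y, hy, -⟩ := read_up_eq_some.1 hq
      rw [rank_up] at hle
      obtain ⟨⟩ := ih (by omega) (hz.of_succ.twist v) hy (by omega)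
      rfl
    | down q => exact (not_read_down_lift_up hz hq).elim
  | @down n v p ih =>
    rw [lift] at hq
    set z' := (insertPair v.rank (c n, false) z).twist v
    have hz' : Fresh c n v.up.rank z' := by
      rw [rank_up]
      exact (hz.insertPair hc hn false).twist v
    cases q with
    | up q =>
      obtain ⟨y, hy, -⟩ := read_up_eq_some.1 hq
      rw [rank_up] at hle
      obtain ⟨⟩ := ih (by omega) hz' hy (by rw [rank_up]; omega)
      rw [rank_up] at hle
      omega
    | down q =>
      obtain ⟨y, hy, hpair, -⟩ := read_down_eq_some.1 hq
      have hqp := ih (by omega) hz' hy (by rw [rank_up, rank_up]; omega)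
      have hread : q.read (p.lift c z') = p.read (p.lift c z') :=
        congrArg (fun s : Σ v, Path n v => s.2.read (p.lift c z')) hqp
      obtain rfl : z' = y := by
        rwa [hread, read_lift, Option.some_inj] at hy
      obtain ⟨hup, hpq⟩ := Sigma.mk.inj_iff.1 hqp
      obtain rfl := eq_of_twist_insertPair hup hpair
      rw [eq_of_heq hpq]

end Path

theorem Fresh.exists {d N : ℕ} (hd : 2 * N < d) : ∃ (c : ℕ → Fin d) (z : Colouring d),
    Set.InjOn c (Set.Iio N) ∧ ∀ r ≤ N, Fresh c N r z := by
  have : NeZero d := ⟨by omega⟩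
  have hinj {i j : ℕ} (hi : i < d) (hj : j < d) (h : Fin.ofNat d i = Fin.ofNat d j) : i = j := by
    simpa [Fin.ext_iff, Nat.mod_eq_of_lt, hi, hj] using h
  refine ⟨Fin.ofNat d, fun i => (Fin.ofNat d (N + i), false), ?_, fun r hr => ⟨?_, ?_⟩⟩
  · intro i hi j hj h
    rw [Set.mem_Iio] at hi hj
    exact hinj (by omega) (by omega) h
  · intro i hi m hm h
    have := hinj (by omega) (by omega) h
    omega
  · intro i j hij hj h
    have := hinj (by omega) (by omega) h
    omega

/-! ### Independence of the cellular basis -/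

section Independence

open Classical in
theorem twist_single {R M : Type*} [CommRing R] [AddCommGroup M] [Module R M] {d : ℕ} (v : Vertex)
    (y : Colouring d) (m : M) : twist (R := R) v (Pi.single y m) = Pi.single (y.twist v) m := by
  funext x
  simp only [twist, LinearMap.funLeft_apply, Pi.single_apply]
  exact if_congr ⟨by rintro rfl; simp, by rintro rfl; simp⟩ rfl rfl

open Classical in
theorem cap_single {R M : Type*} [CommRing R] [AddCommGroup M] [Module R M] {d : ℕ} (p : ℕ)
    (y : Colouring d) (m : M) :
    cap (R := R) p (Pi.single y m) =
      if y p = y (p + 1) then Pi.single (y.removePair p) m else 0 := by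
  funext x
  rw [cap_apply]
  have hiff (a : Colour d) :
      insertPair p a x = y ↔ (y p = y (p + 1) ∧ x = y.removePair p) ∧ a = y p := by
    constructor
    · rintro rfl
      simp
    · rintro ⟨⟨h, rfl⟩, rfl⟩
      exact insertPair_removePair rfl h.symm
  simp only [Pi.single_apply, hiff]
  by_cases h : y p = y (p + 1) <;> by_cases hx : x = y.removePair p <;> simp [h, hx]

variable {R A M : Type*} [CommRing R] [Ring A] [Algebra R A] [AddCommGroup M] [Module R M]
  {d n N : ℕ} {b : ℕ → A} {δ : R} {σ : A →ₗ[R] A} {ρ : A →ₐ[R] Operator R M d} {v : Vertex}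

theorem map_core (hρ : ∀ i < N, ρ (b i) = gen i) (hv : AtLevel n v) (hn : n ≤ N) :
    ρ (core b n v) = stdCup R M d n v * stdCap R M d n v := by
  induction hv with
  | base v =>
    cases v with
    | through r => simp [base, stdCup, stdCap, arcs, rank, twist_through]
    | odd =>
      rw [base, core_two_odd, hρ 0 (by simp only [base] at hn; omega), gen_zero, conjDot_apply]
      simp only [gen, stdCup, stdCap, twist_odd, arcs, rank, Nat.sub_zero, Nat.div_self, pow_one,
        Nat.zero_lt_two, mul_assoc]
  | @add_two n v hv ih =>
    rw [core_add_two b hv, map_mul, hρ _ hn, ih (by omega), gen_succ_mul_stdCup_mul_stdCap hv]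

theorem map_prod_mul_stdCup_apply (hρ : ∀ i < N, ρ (b i) = gen i) (p : Path n v) (hn : n ≤ N)
    (f : Colouring d → M) (x : Colouring d) :
    (ρ (p.prod b) * stdCup R M d n v) f x = (p.read x).elim 0 f := by
  induction p generalizing f with
  | nil => simp [Path.prod, Path.read, stdCup, arcs, twist_through]
  | @up n v p ih =>
    rw [Path.prod_up, map_mul, map_core hρ p.atLevel (by omega), mul_assoc, mul_assoc,
      stdCap_mul_stdCup_succ_up, ← mul_assoc, Module.End.mul_apply, ih (by omega), Path.read]
    cases p.read x <;> rfl
  | @down n v p ih =>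
    rw [Path.prod_down, map_mul, map_core hρ p.atLevel (by omega), mul_assoc, mul_assoc,
      stdCap_up_mul_stdCup_succ p.atLevel, ← mul_assoc, Module.End.mul_apply, ih (by omega),
      Path.read]
    cases p.read x with
    | none => rfl
    | some w =>
      change cup (R := R) v.rank f (w.twist v) = _
      rw [cup_apply, Colouring.twist_apply_succ]
      simp only [Option.bind_some]
      split_ifs <;> rfl

open Classical in
theorem stdCap_mul_map_reverse_prod_single (hρ : ∀ i < N, ρ (b i) = gen i)
    (hb : PairFreeRelations δ N b) (hσ : IsReversal σ b N) (p : Path n v) (hn : n ≤ N)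
    (y : Colouring d) (m : M) :
    (stdCap R M d n v * ρ (σ (p.prod b))) (Pi.single y m) =
      (p.read y).elim 0 fun w => Pi.single w m := by
  induction p with
  | nil => simp [Path.prod, Path.read, stdCap, arcs, twist_through, hσ.map_one]
  | @up n v p ih =>
    rw [Path.prod_up, hσ.map_mul, hσ.map_core hb p.atLevel (by omega), map_mul,
      map_core hρ p.atLevel (by omega), ← mul_assoc, ← mul_assoc, stdCap_succ_up_mul_stdCup,
      mul_assoc, Module.End.mul_apply, ih (by omega), Path.read]
    cases p.read y with
    | none => exact map_zero _
    | some w => exact twist_single v w m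
  | @down n v p ih =>
    rw [Path.prod_down, hσ.map_mul, hσ.map_core hb p.atLevel (by omega), map_mul,
      map_core hρ p.atLevel (by omega), ← mul_assoc, ← mul_assoc,
      stdCap_succ_mul_stdCup_up p.atLevel, mul_assoc, Module.End.mul_apply, ih (by omega),
      Path.read]
    cases p.read y with
    | none => exact map_zero _
    | some w =>
      change cap (R := R) v.rank (twist v (Pi.single w m)) = _
      rw [twist_single, cap_single, Colouring.twist_apply_succ]
      simp only [Option.bind_some]
      split_ifs <;> rfl

open Classical in
theorem map_cell_single_apply (hρ : ∀ i < N, ρ (b i) = gen i) (hb : PairFreeRelations δ N b)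
    (hσ : IsReversal σ b N) (S T : Path N v) (x y : Colouring d) (m : M) :
    ρ (cell b N σ ⟨v, S, T⟩) (Pi.single y m) x =
      (S.read x).elim 0 ((T.read y).elim 0 fun w => Pi.single w m) := by
  rw [← map_prod_mul_stdCup_apply hρ S le_rfl,
    ← stdCap_mul_map_reverse_prod_single hρ hb hσ T le_rfl, cell, map_mul, map_mul,
    map_core hρ S.atLevel le_rfl]
  rfl

open Classical in
theorem map_cell_single_lift_eq_zero (hρ : ∀ i < N, ρ (b i) = gen i)
    (hb : PairFreeRelations δ N b) (hσ : IsReversal σ b N) {c : ℕ → Fin d} {z : Colouring d}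
    (hc : Set.InjOn c (Set.Iio N)) (S T : Path N v) (hz : Fresh c N v.rank z)
    {i : Σ v, Path N v × Path N v} (hi : i ≠ ⟨v, S, T⟩) (hle : i.1.rank ≤ v.rank) (m : M) :
    ρ (cell b N σ i) (Pi.single (T.lift c z) m) (S.lift c z) = 0 := by
  obtain ⟨v', S', T'⟩ := i
  rw [map_cell_single_apply hρ hb hσ]
  cases hS : S'.read (S.lift c z) with
  | none => rfl
  | some w =>
    cases hT : T'.read (T.lift c z) with
    | none => rfl
    | some w' =>
      obtain ⟨⟩ := S.eq_of_read_lift hc le_rfl hz hS hle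
      obtain ⟨⟩ := T.eq_of_read_lift hc le_rfl hz hT le_rfl
      exact absurd rfl hi

/-- The matrix coefficient at the colourings that match a pair of walks isolates the coefficient
of that pair among those with at most as many through strands. -/
theorem smul_eq_zero_of_linearCombination_cell_eq_zero (hρ : ∀ i < N, ρ (b i) = gen i)
    (hb : PairFreeRelations δ N b) (hσ : IsReversal σ b N) (hd : 2 * N < d)
    {l : (Σ v, Path N v × Path N v) →₀ R} (hl : Finsupp.linearCombination R (cell b N σ) l = 0)
    (i : Σ v, Path N v × Path N v) (m : M) : l i • m = 0 := by
  classical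
  obtain ⟨c, z, hc, hz⟩ := Fresh.exists hd
  by_contra hi
  obtain ⟨⟨v, S, T⟩, hST, hmax⟩ := (l.support.filter fun j => l j • m ≠ 0).exists_max_image
    (fun j => j.1.rank) ⟨i, by simpa [hi] using left_ne_zero_of_smul hi⟩
  rw [Finset.mem_filter] at hST
  have hcoeff (j : Σ v, Path N v × Path N v) (hj : j ∈ l.support) (hne : j ≠ ⟨v, S, T⟩) :
      (l j • ρ (cell b N σ j)) (Pi.single (T.lift c z) m) (S.lift c z) = 0 := by
    rw [LinearMap.smul_apply, ← map_smul, ← Pi.single_smul]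
    by_cases hm : l j • m = 0
    · rw [hm, Pi.single_zero, map_zero, Pi.zero_apply]
    · exact map_cell_single_lift_eq_zero hρ hb hσ hc S T (hz _ S.atLevel.rank_le) hne
        (hmax j (Finset.mem_filter.2 ⟨hj, hm⟩)) _
  have hzero : (∑ j ∈ l.support, l j • ρ (cell b N σ j)) (Pi.single (T.lift c z) m)
      (S.lift c z) = 0 := by
    rw [Finsupp.linearCombination_apply, Finsupp.sum] at hl
    simpa only [map_sum, map_smul, map_zero, LinearMap.zero_apply, Pi.zero_apply] using
      congrFun (congrArg (fun a => ρ a (Pi.single (T.lift c z) m)) hl) (S.lift c z)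
  rw [LinearMap.sum_apply, Finset.sum_apply, Finset.sum_eq_single_of_mem _ hST.1 hcoeff] at hzero
  exact hST.2 (by simpa [map_cell_single_apply hρ hb hσ] using hzero)

end Independence

/-! ### The presentation -/

theorem PairFreeRelations.op {R A : Type*} [CommRing R] [Ring A] [Algebra R A] {δ : R} {N : ℕ}
    {b : ℕ → A} (hb : PairFreeRelations δ N b) :
    PairFreeRelations δ N fun i => MulOpposite.op (b i) where
  mul_self i hi := by rw [← MulOpposite.op_mul, hb.mul_self i hi, MulOpposite.op_smul]
  commute i j hij hj h := (hb.commute i j hij hj h).op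
  braid i j h hj := by
    rw [← MulOpposite.op_mul, ← MulOpposite.op_mul, ← mul_assoc, hb.braid i j h hj]
  braid' i j h hj := by
    rw [← MulOpposite.op_mul, ← MulOpposite.op_mul, ← mul_assoc, hb.braid' i j h hj]
  pair hN := by
    have hcomm : Commute (b 0) (b 1) := hb.commute 0 1 one_pos hN (by simp [Joined])
    rw [← MulOpposite.op_mul, hcomm.eq, hb.pair hN, MulOpposite.op_zero]

theorem coxeterGraphD_adj_iff_joined {n : ℕ} {i j : Fin n} (h : i < j) :
    (coxeterGraphD n).Adj i j ↔ Joined i j := by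
  rw [coxeterGraphD, SimpleGraph.fromRel_adj, Joined]
  simp only [Fin.lt_def, ne_eq, Fin.ext_iff] at h ⊢
  omega

end PairFree

namespace PFTLD

open PairFree

variable {n : ℕ}

/-- The quotient map from the free algebra onto `PFTL(D_n)`. -/
noncomputable def mk (n : ℕ) : FreeAlgebra ℤ[X] (Fin n) →ₐ[ℤ[X]] PFTLD n :=
  AlgHom.comp (B := TLD n) (RingQuot.mkAlgHom ℤ[X] (PFTLD.Rel n)) (TLD.mk n)

/-- The generators of `PFTL(D_n)`, extended by zero to a sequence. -/
noncomputable def generator (n i : ℕ) : PFTLD n :=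
  if h : i < n then mk n (FreeAlgebra.ι ℤ[X] ⟨i, h⟩) else 0

theorem generator_of_lt {i : ℕ} (h : i < n) :
    generator n i = mk n (FreeAlgebra.ι ℤ[X] ⟨i, h⟩) :=
  dif_pos h

theorem mk_eq_of_rel {x y : FreeAlgebra ℤ[X] (Fin n)} (h : TLD.Rel n x y) : mk n x = mk n y :=
  congrArg (RingQuot.mkAlgHom ℤ[X] (PFTLD.Rel n)) (RingQuot.mkAlgHom_rel ℤ[X] h)

theorem mk_ι_mul_mk_ι {i j : Fin n} (hi : i.val = 1) (hj : j.val = 0) :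
    mk n (FreeAlgebra.ι ℤ[X] i) * mk n (FreeAlgebra.ι ℤ[X] j) = 0 := by
  have h := RingQuot.mkAlgHom_rel ℤ[X] (Rel.pair i j hi hj)
  rwa [map_mul, map_zero] at h

theorem pairFreeRelations_generator (n : ℕ) : PairFreeRelations (X : ℤ[X]) n (generator n) where
  mul_self i hi := by
    simpa only [generator_of_lt hi, map_mul, map_smul] using mk_eq_of_rel (.sq ⟨i, hi⟩)
  commute i j hij hj h := by
    have hadj := mt (coxeterGraphD_adj_iff_joined (i := ⟨i, hij.trans hj⟩) (j := ⟨j, hj⟩) hij).1 h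
    simpa only [generator_of_lt (hij.trans hj), generator_of_lt hj, map_mul, commute_iff_eq] using
      mk_eq_of_rel (.comm _ _ hadj)
  braid i j h hj := by
    have hij := PairFree.Joined.lt h
    have hadj := (coxeterGraphD_adj_iff_joined (i := ⟨i, hij.trans hj⟩) (j := ⟨j, hj⟩) hij).2 h
    simpa only [generator_of_lt (hij.trans hj), generator_of_lt hj, map_mul] using
      mk_eq_of_rel (.braid _ _ hadj)
  braid' i j h hj := by
    have hij := PairFree.Joined.lt h
    have hadj := (coxeterGraphD_adj_iff_joined (i := ⟨i, hij.trans hj⟩) (j := ⟨j, hj⟩) hij).2 h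
    simpa only [generator_of_lt (hij.trans hj), generator_of_lt hj, map_mul] using
      mk_eq_of_rel (.braid _ _ hadj.symm)
  pair hn := by
    rw [generator_of_lt hn, generator_of_lt (one_pos.trans hn)]
    exact mk_ι_mul_mk_ι rfl rfl

theorem lift_ι_eq_of_rel {B : Type*} [Ring B] [Algebra ℤ[X] B] {β : ℕ → B}
    (hβ : PairFreeRelations (X : ℤ[X]) n β) {x y : FreeAlgebra ℤ[X] (Fin n)}
    (h : TLD.Rel n x y) :
    FreeAlgebra.lift ℤ[X] (fun i : Fin n => β i) x =
      FreeAlgebra.lift ℤ[X] (fun i : Fin n => β i) y := by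
  obtain i | ⟨i, j, h⟩ | ⟨i, j, h⟩ := h
  · simpa using hβ.mul_self i i.2
  · obtain hij | rfl | hij := lt_trichotomy i j
    · simpa using (hβ.commute i j hij j.2 (mt (coxeterGraphD_adj_iff_joined hij).2 h)).eq
    · rfl
    · rw [SimpleGraph.adj_comm] at h
      simpa using (hβ.commute j i hij i.2 (mt (coxeterGraphD_adj_iff_joined hij).2 h)).eq.symm
  · obtain hij | hij := lt_or_gt_of_ne h.ne
    · simpa using hβ.braid i j ((coxeterGraphD_adj_iff_joined hij).1 h) j.2
    · simpa using hβ.braid' j i ((coxeterGraphD_adj_iff_joined hij).1 h.symm) i.2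

theorem exists_algHom_generator {B : Type*} [Ring B] [Algebra ℤ[X] B] {β : ℕ → B}
    (hβ : PairFreeRelations (X : ℤ[X]) n β) :
    ∃ φ : PFTLD n →ₐ[ℤ[X]] B, ∀ i < n, φ (generator n i) = β i := by
  let φ' : TLD n →ₐ[ℤ[X]] B := RingQuot.liftAlgHom ℤ[X]
    ⟨FreeAlgebra.lift ℤ[X] fun i : Fin n => β i, fun _ _ => lift_ι_eq_of_rel hβ⟩
  have hφ' (i : Fin n) : φ' (TLD.b i) = β i :=
    (RingQuot.liftAlgHom_mkAlgHom_apply ℤ[X] _ _ _).trans (FreeAlgebra.lift_ι_apply _ _)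
  have hrel ⦃x y : TLD n⦄ (h : Rel n x y) : φ' x = φ' y := by
    obtain ⟨i, j, hi, hj⟩ := h
    rw [map_mul, map_zero, hφ', hφ', hi, hj, hβ.pair (hi ▸ i.2)]
  refine ⟨RingQuot.liftAlgHom ℤ[X] ⟨φ', hrel⟩, fun i hi => ?_⟩
  rw [generator_of_lt hi]
  exact (RingQuot.liftAlgHom_mkAlgHom_apply ℤ[X] φ' hrel (TLD.b ⟨i, hi⟩)).trans (hφ' _)

theorem mk_surjective (n : ℕ) : Function.Surjective (mk n) :=
  (RingQuot.mkAlgHom_surjective ℤ[X] (PFTLD.Rel n)).comp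
    (RingQuot.mkAlgHom_surjective ℤ[X] (TLD.Rel n))

theorem adjoin_generator (n : ℕ) : Algebra.adjoin ℤ[X] (generator n '' Set.Iio n) = ⊤ := by
  rw [← (mk n).range_eq_top.2 (mk_surjective n), ← Algebra.map_top, ← FreeAlgebra.adjoin_range_ι,
    AlgHom.map_adjoin]
  congr 1
  ext x
  simp only [Set.mem_image, Set.mem_Iio, Set.mem_range, exists_exists_eq_and]
  constructor
  · rintro ⟨i, hi, rfl⟩
    exact ⟨⟨i, hi⟩, (generator_of_lt hi).symm⟩
  · rintro ⟨i, rfl⟩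
    exact ⟨i, i.2, generator_of_lt i.2⟩

theorem level_eq_top (hn : 2 ≤ n) : level ℤ[X] (generator n) n = ⊤ := by
  have hset : {i | max i 1 < n} = Set.Iio n := by
    ext i
    simp only [Set.mem_ofPred_eq, Set.mem_Iio]
    omega
  rw [level, hset, adjoin_generator, Algebra.top_toSubmodule]

theorem exists_isReversal (n : ℕ) :
    ∃ σ : PFTLD n →ₗ[ℤ[X]] PFTLD n, IsReversal σ (generator n) n := by
  obtain ⟨φ, hφ⟩ := exists_algHom_generator (pairFreeRelations_generator n).op
  have hφφ : (AlgHom.opComm φ).comp φ = AlgHom.id ℤ[X] (PFTLD n) := by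
    refine AlgHom.ext_of_adjoin_eq_top (adjoin_generator n) ?_
    rintro _ ⟨i, hi, rfl⟩
    simp [hφ i hi]
  refine ⟨(MulOpposite.opLinearEquiv ℤ[X]).symm.toLinearMap ∘ₗ φ.toLinearMap, ?_, ?_, ?_⟩
  · exact fun x => DFunLike.congr_fun hφφ x
  · intro x y
    simp
  · intro i hi
    simp [hφ i hi]

theorem linearIndependent_cell {σ : PFTLD n →ₗ[ℤ[X]] PFTLD n}
    (hσ : IsReversal σ (generator n) n) : LinearIndependent ℤ[X] (cell (generator n) n σ) := by
  refine linearIndependent_iff.2 fun l hl => Finsupp.ext fun i => ?_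
  have hroot (d : ℕ) (hd : 2 * n < d) : (l i).IsRoot ((2 * d : ℕ) : ℤ) := by
    have hX (m : Module.AEval ℤ ℤ ((2 * d : ℕ) : ℤ)) : (X : ℤ[X]) • m = (2 * d) • m := by
      rw [← (Module.AEval.of ℤ ℤ _).apply_symm_apply m, Module.AEval.X_smul_of, smul_eq_mul,
        ← nsmul_eq_mul, map_nsmul]
    obtain ⟨ρ, hρ⟩ := exists_algHom_generator (pairFreeRelations_gen hX n)
    have h := smul_eq_zero_of_linearCombination_cell_eq_zero hρ (pairFreeRelations_generator n) hσ
      hd hl i (Module.AEval.of ℤ ℤ _ 1)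
    rwa [← Module.AEval.of_aeval_smul, LinearEquiv.map_eq_zero_iff, smul_eq_mul, mul_one,
      coe_aeval_eq_eval] at h
  refine eq_zero_of_infinite_isRoot _ <| Set.infinite_of_injective_forall_mem
    (f := fun k : ℕ => ((2 * (2 * n + 1 + k) : ℕ) : ℤ)) ?_ fun k => hroot _ (by omega)
  intro k k' h
  simpa using h

end PFTLD

theorem mainTheorem2 (n : ℕ) (hn : 4 ≤ n) : IsCellular ℤ[X] (PFTLD n) := by
  obtain ⟨σ, hσ⟩ := PFTLD.exists_isReversal n
  exact (PFTLD.pairFreeRelations_generator n).isCellular hσ (PFTLD.level_eq_top (by omega))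
    (PFTLD.linearIndependent_cell hσ)
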